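/- Let $G=(V,E)$ be a finite median graph with $n$ vertices and $m$ edges, that is, a finite simple connected graph such that for all $x,y,z\in V$ the set $I(x,y)\cap I(y,z)\cap I(z,x)$ is a singleton, where $I(u,v)=\{x\in V: d(u,x)+d(x,v)=d(u,v)\}$. Let $w:V\to[0,\infty)$, write $w(S)=\sum_{x\in S}w(x)$ for $S\subseteq V$, and let $$W_w(G)=\sum_{\{u,v\}\subseteq V}w(u)\,w(v)\,d(u,v)$$ be the weighted Wiener index, the sum being over unordered pairs of vertices. (1) Let $\Theta$ be the reflexive and transitive closure of the relation on $E$ that holds for two edges when they are opposite edges of a $4$-cycle of $G$, and let $E_1,\dots,E_q$ be the equivalence classes of $\Theta$. For each $i$, the graph $(V,E\setminus E_i)$ has exactly two connected components $H'_i$ and $H''_i$, and $$W_w(G)=\sum_{i=1}^q w(H'_i)\,w(H''_i).$$ (2) $W_w(G)$ can be computed in $O(m)$ time (in constant time if $m=0$). That is, there are one program for a random access machine and constants $C,k$ such that for every median graph $G$ on $\{0,\dots,n-1\}$ and every $w$, given adjacency lists of $G$ (in any order) and the values of $w$, the program stops after at most $C(m+1)$ steps with $W_w(G)$ as its output. The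 machine has variables and arrays that hold words (integers between $0$ and $(n+m+1)^k$) or real numbers, initially $0$ outside the input. A step is an arithmetic operation $+,-,\times$ on words or on reals, an assignment, an access to an array at a position given by a word, or a comparison; words and reals are not converted into each other. -/

import Mathlib

/-! ### Median graphs, weights and the Wiener index -/

/-- The interval `I(u,v)`: all vertices on shortest `(u,v)`-paths. -/
def SimpleGraph.geodInterval {V : Type*} (G : SimpleGraph V) (u v : V) : Set V :=
  {x | G.dist u x + G.dist x v = G.dist u v}

/-- Median graphs: connected, and the three intervals between any three vertices
meet in exactly one vertex. -/
structure SimpleGraph.IsMedianGraph {V : Type*} (G : SimpleGraph V) : Prop where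
  connected : G.Connected
  median : ∀ x y z : V, ∃ c : V,
    G.geodInterval x y ∩ G.geodInterval y z ∩ G.geodInterval z x = {c}

/-- The weighted Wiener index: the sum of `w(u) w(v) d(u,v)` over the unordered pairs `{u,v}`
of vertices (the pairs with `u = v` contribute `0`). -/
noncomputable def SimpleGraph.wienerIndex {V : Type*} [Fintype V] [DecidableEq V]
    (G : SimpleGraph V) (w : V → ℝ) : ℝ :=
  ∑ e : Sym2 V, Sym2.lift ⟨fun u v => w u * w v * (G.dist u v : ℝ), fun u v => by
    simp only [G.dist_comm (u := u), mul_comm (w u)]⟩ e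

/-- The weight `w(S)` of a set of vertices. -/
noncomputable def setWeight {V : Type*} [Fintype V] (w : V → ℝ) (S : Set V) : ℝ :=
  ∑ v, S.indicator w v

/-- `e` and `e'` are opposite edges `uv`, `u'v'` of a square (4-cycle) `u v v' u'` of `G`. -/
def SimpleGraph.OppositeInSquare {V : Type*} (G : SimpleGraph V) (e e' : Sym2 V) : Prop :=
  ∃ u v u' v' : V, e = s(u, v) ∧ e' = s(u', v') ∧
    G.Adj u v ∧ G.Adj v v' ∧ G.Adj v' u' ∧ G.Adj u' u ∧ u ≠ v' ∧ v ≠ u'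

/-- The Θ-classes: the classes of edges for the reflexive and transitive closure of the
(symmetric) relation "opposite in a square". -/
def SimpleGraph.thetaClasses {V : Type*} (G : SimpleGraph V) : Set (Set (Sym2 V)) :=
  {E | ∃ e ∈ G.edgeSet, E = {e' | Relation.ReflTransGen G.OppositeInSquare e e'}}

/-- `A` and `B` are the two connected components, and there are no others, of the graph obtained
from `G` by deleting the edges in `E`. -/
def SimpleGraph.AreTheTwoComponents {V : Type*} (G : SimpleGraph V) (E : Set (Sym2 V))
    (A B : Set V) : Prop :=
  A ≠ B ∧ {S : Set V | ∃ c : (G.deleteEdges E).ConnectedComponent, S = c.supp} = {A, B}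

/-! ### A real random access machine with a step count

A program has finitely many word variables, real variables, arrays of words and arrays of reals.
Words are natural numbers bounded by a number `B`; an instruction that would write a larger word
does not execute. On reals there are only `+`, `-`, `*`, integer constants and comparisons: there
is no rounding and no conversion between reals and words. Every elementary instruction and every
evaluation of a test costs one step. -/

namespace RealRAM

/-- The contents of the variables and of the arrays, which are indexed by a name and, for
arrays, a position. -/
structure State where
  word : ℕ → ℕ
  real : ℕ → ℝ
  wordArr : ℕ → ℕ → ℕ
  realArr : ℕ → ℕ → ℝ

/-- Arithmetic operations. -/
inductive Op where
  | add | sub | mul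

/-- Operations on words; the difference is truncated at `0`. -/
def Op.onWords : Op → ℕ → ℕ → ℕ
  | .add, a, b => a + b
  | .sub, a, b => a - b
  | .mul, a, b => a * b

/-- Operations on reals. -/
noncomputable def Op.onReals : Op → ℝ → ℝ → ℝ
  | .add, a, b => a + b
  | .sub, a, b => a - b
  | .mul, a, b => a * b

/-- Elementary instructions. The names of variables and arrays and the constants are fixed in the
program; the position in an array is the content of a word variable. -/
inductive Instr where
  /-- word variable `x` becomes the constant `c` -/
  | wconst (x c : ℕ)
  /-- word variable `x` becomes word variable `y` -/
  | wmove (x y : ℕ)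
  /-- word variable `x` becomes (word variable `y`) `o` (word variable `z`) -/
  | wop (o : Op) (x y z : ℕ)
  /-- word variable `x` becomes entry (word variable `i`) of word array `a` -/
  | wload (x a i : ℕ)
  /-- entry (word variable `i`) of word array `a` becomes word variable `y` -/
  | wstore (a i y : ℕ)
  /-- real variable `x` becomes the constant `c` -/
  | rconst (x : ℕ) (c : ℤ)
  /-- real variable `x` becomes real variable `y` -/
  | rmove (x y : ℕ)
  /-- real variable `x` becomes (real variable `y`) `o` (real variable `z`) -/
  | rop (o : Op) (x y z : ℕ)
  /-- real variable `x` becomes entry (word variable `i`) of real array `a` -/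
  | rload (x a i : ℕ)
  /-- entry (word variable `i`) of real array `a` becomes real variable `y` -/
  | rstore (a i y : ℕ)

/-- Write the word `v` into variable `x`, provided that `v ≤ B`. -/
def State.setWord (B : ℕ) (s : State) (x v : ℕ) : Option State :=
  if v ≤ B then some { s with word := Function.update s.word x v } else none

/-- Write the word `v` at position `i` of array `a`, provided that `v ≤ B`. -/
def State.setWordArr (B : ℕ) (s : State) (a i v : ℕ) : Option State :=
  if v ≤ B then
    some { s with wordArr := Function.update s.wordArr a (Function.update (s.wordArr a) i v) }
  else none

/-- Write the real `v` into variable `x`. -/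
def State.setReal (s : State) (x : ℕ) (v : ℝ) : State :=
  { s with real := Function.update s.real x v }

/-- Write the real `v` at position `i` of array `a`. -/
def State.setRealArr (s : State) (a i : ℕ) (v : ℝ) : State :=
  { s with realArr := Function.update s.realArr a (Function.update (s.realArr a) i v) }

/-- The effect of an elementary instruction; `none` if a word would exceed `B`. -/
noncomputable def Instr.exec (B : ℕ) : Instr → State → Option State
  | .wconst x c, s => s.setWord B x c
  | .wmove x y, s => s.setWord B x (s.word y)
  | .wop o x y z, s => s.setWord B x (o.onWords (s.word y) (s.word z))
  | .wload x a i, s => s.setWord B x (s.wordArr a (s.word i))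
  | .wstore a i y, s => s.setWordArr B a (s.word i) (s.word y)
  | .rconst x c, s => some (s.setReal x c)
  | .rmove x y, s => some (s.setReal x (s.real y))
  | .rop o x y z, s => some (s.setReal x (o.onReals (s.real y) (s.real z)))
  | .rload x a i, s => some (s.setReal x (s.realArr a (s.word i)))
  | .rstore a i y, s => some (s.setRealArr a (s.word i) (s.real y))

/-- Tests: comparisons of two word variables or of two real variables. -/
inductive Test where
  | wlt (x y : ℕ)
  | weq (x y : ℕ)
  | rlt (x y : ℕ)

/-- The truth of a test. -/
def Test.Holds : Test → State → Prop
  | .wlt x y, s => s.word x < s.word y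
  | .weq x y, s => s.word x = s.word y
  | .rlt x y, s => s.real x < s.real y

/-- Programs. -/
inductive Program where
  | skip
  | instr (i : Instr)
  | seq (p q : Program)
  | ite (b : Test) (p q : Program)
  | loop (b : Test) (p : Program)

/-- `Exec B p s t s'`: with words bounded by `B`, program `p` started in state `s` terminates in
state `s'` after exactly `t` steps. -/
inductive Exec (B : ℕ) : Program → State → ℕ → State → Prop where
  | skip (s : State) : Exec B .skip s 1 s
  | instr {i : Instr} {s s' : State} : i.exec B s = some s' → Exec B (.instr i) s 1 s'
  | seq {p q : Program} {s s' s'' : State} {t t' : ℕ} :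
      Exec B p s t s' → Exec B q s' t' s'' → Exec B (.seq p q) s (t + t') s''
  | ite_true {b : Test} {p q : Program} {s s' : State} {t : ℕ} :
      b.Holds s → Exec B p s t s' → Exec B (.ite b p q) s (1 + t) s'
  | ite_false {b : Test} {p q : Program} {s s' : State} {t : ℕ} :
      ¬ b.Holds s → Exec B q s t s' → Exec B (.ite b p q) s (1 + t) s'
  | loop_true {b : Test} {p : Program} {s s' s'' : State} {t t' : ℕ} :
      b.Holds s → Exec B p s t s' → Exec B (.loop b p) s' t' s'' →
      Exec B (.loop b p) s (1 + t + t') s''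
  | loop_false {b : Test} {p : Program} {s : State} :
      ¬ b.Holds s → Exec B (.loop b p) s 1 s

/-- The arrays `off` and `tgt` store adjacency lists of `G`, in an arbitrary order within each
list: the entries of `tgt` at the positions `off v, …, off (v + 1) - 1` are the neighbours of
`v`, each listed once. The unused entries are `0`. -/
structure IsAdjacencyLists {n : ℕ} (G : SimpleGraph (Fin n)) (off tgt : ℕ → ℕ) : Prop where
  off_zero : off 0 = 0
  off_le : ∀ v : ℕ, v < n → off v ≤ off (v + 1)
  lists : ∀ v : Fin n, Set.BijOn tgt (Set.Ico (off v) (off (v + 1)))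
    {u | ∃ x : Fin n, G.Adj v x ∧ u = x}
  off_unused : ∀ v : ℕ, n < v → off v = 0
  tgt_unused : ∀ j : ℕ, off n ≤ j → tgt j = 0

/-- The initial state: the word variables `0` and `1` hold the numbers of vertices and of edges,
the word arrays `0` and `1` hold the adjacency lists, the real array `0` holds the weights of the
vertices, and everything else is `0`. -/
noncomputable def inputState {n : ℕ} (G : SimpleGraph (Fin n)) (w : Fin n → ℝ)
    (off tgt : ℕ → ℕ) : State where
  word x := if x = 0 then n else if x = 1 then G.edgeSet.ncard else 0
  real _ := 0
  wordArr a := if a = 0 then off else if a = 1 then tgt else fun _ => 0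
  realArr a i := if a = 0 then (if h : i < n then w ⟨i, h⟩ else 0) else 0

end RealRAM

/-! Median graphs are bipartite, so an edge uv splits the vertices into the halfspace of those
closer to u and its complement. Opposite edges of a square define the same halfspace, as otherwise a
K₂,₃ would appear (`halfspace_eq_of_square`), and the quadrangle condition links all edges that
leave a halfspace by chains of squares (`halfspace_eq_and_reflTransGen`). Hence the Θ-classes are
the cuts of the halfspaces, and for a fixed root r each class belongs to exactly one halfspace
avoiding r. An edge crosses exactly one of these and a shortest path crosses none twice, so d(x,y)
is the number of halfspaces separating x from y (`dist_eq_ncard_separators`). Exchanging the two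
summations gives the formula.

For the running time, number the vertices by breadth-first search from r. A halfspace avoiding r is
named by the number of its first vertex, its gate. For v ≠ r let S be the halfspace containing v
whose gate comes last. Exactly one earlier neighbour of v, the parent, lies outside S
(`exists_adj_notMem`). All other earlier neighbours carry the label of S and the parent carries a
smaller one, so parent and label of v can be read off from the labels of its earlier neighbours
(`label_spec`). In the reverse order the weight of v is then moved to its parent. Only S loses this
weight, and it is booked under the label of S; in the end the bookings are the weights w(S)
(`SweepState.step`). Each adjacency entry is read once, and n ≤ m + 1 by connectedness. -/

namespace SimpleGraph

/-! ### Halfspaces of median graphs and squares. -/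

/-- The vertices closer to `u` than to `v`. -/
def halfspace {V : Type*} (G : SimpleGraph V) (u v : V) : Set V :=
  {x | G.dist x u < G.dist x v}

theorem mem_halfspace {V : Type*} {G : SimpleGraph V} {u v x : V} :
    x ∈ G.halfspace u v ↔ G.dist x u < G.dist x v := Iff.rfl

theorem Connected.exists_adj_dist_eq {V : Type*} {G : SimpleGraph V} (hG : G.Connected)
    {x u : V} {k : ℕ} (h : G.dist x u = k + 1) : ∃ y, G.Adj x y ∧ G.dist y u = k := by
  obtain ⟨p, hp⟩ := hG.exists_walk_length_eq_dist x u
  cases p with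
  | nil => simp at h
  | @cons _ y _ hxy q =>
    refine ⟨y, hxy, le_antisymm ?_ ?_⟩
    · have := dist_le q
      simp only [Walk.length_cons] at hp
      omega
    · have h1 := hG.dist_triangle (u := x) (v := y) (w := u)
      have h2 := dist_eq_one_iff_adj.2 hxy
      omega

namespace IsMedianGraph

variable {V : Type*} {G : SimpleGraph V}

theorem exists_median (hG : G.IsMedianGraph) (x y z : V) :
    ∃ c, G.dist x c + G.dist c y = G.dist x y ∧ G.dist y c + G.dist c z = G.dist y z ∧
      G.dist z c + G.dist c x = G.dist z x := by
  obtain ⟨c, hc⟩ := hG.median x y z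
  have : c ∈ G.geodInterval x y ∩ G.geodInterval y z ∩ G.geodInterval z x := by
    rw [hc]; rfl
  exact ⟨c, this.1.1, this.1.2, this.2⟩

theorem median_unique (hG : G.IsMedianGraph) {x y z c c' : V}
    (h1 : G.dist x c + G.dist c y = G.dist x y) (h2 : G.dist y c + G.dist c z = G.dist y z)
    (h3 : G.dist z c + G.dist c x = G.dist z x)
    (h1' : G.dist x c' + G.dist c' y = G.dist x y) (h2' : G.dist y c' + G.dist c' z = G.dist y z)
    (h3' : G.dist z c' + G.dist c' x = G.dist z x) : c = c' := by
  obtain ⟨m, hm⟩ := hG.median x y z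
  have a : c ∈ G.geodInterval x y ∩ G.geodInterval y z ∩ G.geodInterval z x := ⟨⟨h1, h2⟩, h3⟩
  have b : c' ∈ G.geodInterval x y ∩ G.geodInterval y z ∩ G.geodInterval z x := ⟨⟨h1', h2'⟩, h3'⟩
  rw [hm] at a b
  exact a.trans b.symm

/-- Median graphs are bipartite. -/
theorem dist_adj (hG : G.IsMedianGraph) {u v : V} (h : G.Adj u v) (x : V) :
    G.dist x u = G.dist x v + 1 ∨ G.dist x v = G.dist x u + 1 := by
  obtain ⟨c, h1, h2, h3⟩ := hG.exists_median x u v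
  have huv := dist_eq_one_iff_adj.2 h
  have e1 := G.dist_comm (u := u) (v := x)
  have e2 := G.dist_comm (u := v) (v := x)
  have e3 := G.dist_comm (u := u) (v := c)
  have e4 := G.dist_comm (u := v) (v := c)
  have e5 := G.dist_comm (u := x) (v := c)
  rcases Nat.eq_zero_or_pos (G.dist u c) with h0 | h0
  · have : u = c := hG.connected.dist_eq_zero_iff.1 h0
    subst this
    omega
  · have : G.dist c v = 0 := by omega
    have : c = v := hG.connected.dist_eq_zero_iff.1 this
    subst this
    omega

theorem compl_halfspace (hG : G.IsMedianGraph) {u v : V} (h : G.Adj u v) :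
    (G.halfspace u v)ᶜ = G.halfspace v u := by
  ext x
  simp only [Set.mem_compl_iff, mem_halfspace]
  have := hG.dist_adj h x
  omega

theorem dist_eq_two (hG : G.IsMedianGraph) {u v w : V} (h1 : G.Adj v u) (h2 : G.Adj u w)
    (h : v ≠ w) : G.dist v w = 2 := by
  have e1 := hG.dist_adj h2 v
  have e2 := dist_eq_one_iff_adj.2 h1
  have e3 := hG.connected.pos_dist_of_ne h
  omega

/-- The quadrangle condition. -/
theorem quadrangle (hG : G.IsMedianGraph) {u v w z : V} {k : ℕ} (hv : G.Adj u v) (hw : G.Adj u w)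
    (hvw : v ≠ w) (hvz : G.dist v z = k) (hwz : G.dist w z = k) (huz : G.dist u z = k + 1) :
    ∃ c, G.Adj v c ∧ G.Adj w c ∧ G.dist c z + 1 = k := by
  obtain ⟨c, h1, h2, h3⟩ := hG.exists_median v w z
  have h := hG.dist_eq_two hv.symm hw hvw
  have e1 := G.dist_comm (u := w) (v := c)
  have e2 := G.dist_comm (u := z) (v := v)
  have e3 := G.dist_comm (u := z) (v := c)
  have e4 := G.dist_comm (u := c) (v := v)
  exact ⟨c, dist_eq_one_iff_adj.1 (by omega), dist_eq_one_iff_adj.1 (by omega), by omega⟩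

/-- There is no `K₂,₃`. -/
theorem eq_of_three_common_neighbors (hG : G.IsMedianGraph) {a b x y z : V}
    (hxy : x ≠ y) (hyz : y ≠ z) (hzx : z ≠ x) (ax : G.Adj a x) (ay : G.Adj a y) (az : G.Adj a z)
    (bx : G.Adj b x) (byy : G.Adj b y) (bz : G.Adj b z) : a = b := by
  have d {p q : V} (h : G.Adj p q) : G.dist p q = 1 := dist_eq_one_iff_adj.2 h
  have h1 := hG.dist_eq_two ax.symm ay hxy
  have h2 := hG.dist_eq_two ay.symm az hyz
  have h3 := hG.dist_eq_two az.symm ax hzx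
  -- The vertices x, y, z are pairwise at distance 2, so `a` and `b` are both medians of them.
  refine hG.median_unique (x := x) (y := y) (z := z) ?_ ?_ ?_ ?_ ?_ ?_
  · rw [d ax.symm, d ay, h1]
  · rw [d ay.symm, d az, h2]
  · rw [d az.symm, d ax, h3]
  · rw [d bx.symm, d byy, h1]
  · rw [d byy.symm, d bz, h2]
  · rw [d bz.symm, d bx, h3]

/-- If x violated the inclusion, then by bipartiteness u and v' would have the same distance k from
x, and v and u' the distance k + 1. The quadrangle condition at v gives a common neighbour c of u
and v' at distance k - 1, so u and v' would have the three common neighbours v, u', c. -/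
theorem halfspace_subset_of_square (hG : G.IsMedianGraph) {u v u' v' : V} (huv : G.Adj u v)
    (hvv : G.Adj v v') (hvu : G.Adj v' u') (huu : G.Adj u' u) (h1 : u ≠ v') (h2 : v ≠ u') :
    G.halfspace u v ⊆ G.halfspace u' v' := by
  intro x hx
  rw [mem_halfspace] at hx ⊢
  by_contra hcon
  have a1 := hG.dist_adj huv x
  have a2 := hG.dist_adj hvv x
  have a3 := hG.dist_adj hvu x
  have a4 := hG.dist_adj huu x
  obtain ⟨c, c1, c2, c3⟩ := hG.quadrangle (u := v) (v := u) (w := v') (z := x) (k := G.dist x u)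
    huv.symm hvv h1 (dist_comm ..) (by rw [dist_comm]; omega) (by rw [dist_comm]; omega)
  rw [dist_comm] at c3
  refine h1 (hG.eq_of_three_common_neighbors (x := v) (y := u') (z := c) h2 ?_ ?_
    huv huu.symm c1 hvv.symm hvu c2)
  · rintro rfl; omega
  · rintro rfl; omega

theorem halfspace_eq_of_square (hG : G.IsMedianGraph) {u v u' v' : V} (huv : G.Adj u v)
    (hvv : G.Adj v v') (hvu : G.Adj v' u') (huu : G.Adj u' u) (h1 : u ≠ v') (h2 : v ≠ u') :
    G.halfspace u v = G.halfspace u' v' :=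
  (hG.halfspace_subset_of_square huv hvv hvu huu h1 h2).antisymm
    (hG.halfspace_subset_of_square hvu.symm hvv.symm huv.symm huu.symm h2.symm h1.symm)

/-- The edges leaving a halfspace define the same halfspace and are in the same Θ-class. -/
theorem halfspace_eq_and_reflTransGen (hG : G.IsMedianGraph) {u v : V} (huv : G.Adj u v) (k : ℕ) :
    ∀ {x y : V}, G.Adj x y → x ∈ G.halfspace u v → y ∈ G.halfspace v u → G.dist x u = k →
      G.halfspace x y = G.halfspace u v ∧
        Relation.ReflTransGen G.OppositeInSquare s(u, v) s(x, y) := by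
  induction k with
  | zero =>
    intro x y hxy hx hy hk
    have hxu : x = u := hG.connected.dist_eq_zero_iff.1 hk
    subst hxu
    rw [mem_halfspace, dist_eq_one_iff_adj.2 hxy.symm] at hy
    have : y = v := hG.connected.dist_eq_zero_iff.1 (by omega)
    subst this
    exact ⟨rfl, .refl⟩
  | succ k ih =>
    intro x y hxy hx hy hk
    rw [mem_halfspace] at hx hy
    have a1 := hG.dist_adj huv x
    have a2 := hG.dist_adj huv y
    have a3 := hG.dist_adj hxy u
    have a4 := hG.dist_adj hxy v
    simp only [G.dist_comm (u := u), G.dist_comm (u := v)] at a3 a4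
    -- Step from y towards v to y'. Both x and y' are nearer to u than y is, so the quadrangle
    -- condition closes a square x y y' c, and the induction hypothesis applies to the edge cy'.
    obtain ⟨y', hy', hy'v⟩ := hG.connected.exists_adj_dist_eq (x := y) (u := v) (k := k) (by omega)
    have b1 := hG.dist_adj huv y'
    have b2 := hG.dist_adj hy' u
    simp only [G.dist_comm (u := u)] at b2
    have hne : x ≠ y' := by rintro rfl; omega
    obtain ⟨c, c1, c2, c3⟩ := hG.quadrangle (u := y) (v := x) (w := y') (z := u) (k := k + 1)
      hxy.symm hy' hne (by omega) (by omega) (by omega)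
    have d1 := hG.dist_adj huv c
    have d2 := hG.dist_adj c1 v
    simp only [G.dist_comm (u := v)] at d2
    have hne2 : c ≠ y := by rintro rfl; omega
    obtain ⟨i1, i2⟩ := ih c2.symm (show G.dist c u < G.dist c v by omega)
      (show G.dist y' v < G.dist y' u by omega) (by omega)
    refine ⟨?_, i2.tail ⟨c, y', x, y, rfl, rfl, c2.symm, hy'.symm, hxy.symm, c1, hne2, hne.symm⟩⟩
    rw [← i1]
    exact hG.halfspace_eq_of_square hxy hy' c2 c1.symm hne hne2.symm

theorem halfspace_eq_of_adj (hG : G.IsMedianGraph) {u v x y : V} (huv : G.Adj u v)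
    (hxy : G.Adj x y) (hx : x ∈ G.halfspace u v) (hy : y ∉ G.halfspace u v) :
    G.halfspace x y = G.halfspace u v := by
  rw [← Set.mem_compl_iff, hG.compl_halfspace huv] at hy
  exact (hG.halfspace_eq_and_reflTransGen huv _ hxy hx hy rfl).1

theorem left_mem_halfspace {u v : V} (h : G.Adj u v) : u ∈ G.halfspace u v := by
  rw [mem_halfspace, dist_self, dist_eq_one_iff_adj.2 h]; exact Nat.one_pos

theorem right_notMem_halfspace {u v : V} : v ∉ G.halfspace u v := by
  rw [mem_halfspace, dist_self]; omega

/-! ### Distance as the number of separating halfspaces. -/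

/-- The halfspaces that do not contain the vertex `r`. -/
def _root_.SimpleGraph.halfspaces (G : SimpleGraph V) (r : V) : Set (Set V) :=
  {S | r ∉ S ∧ ∃ u v, G.Adj u v ∧ S = G.halfspace u v}

theorem eq_halfspace (hG : G.IsMedianGraph) {r : V} {S : Set V} (hS : S ∈ G.halfspaces r)
    {x y : V} (hxy : G.Adj x y) (hx : x ∈ S) (hy : y ∉ S) : S = G.halfspace x y := by
  obtain ⟨_, u, v, huv, rfl⟩ := hS
  exact (hG.halfspace_eq_of_adj huv hxy hx hy).symm

theorem halfspace_mem_halfspaces {r : V} {u v : V} (huv : G.Adj u v)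
    (h : G.dist r v < G.dist r u) : G.halfspace u v ∈ G.halfspaces r :=
  ⟨by rw [mem_halfspace]; omega, u, v, huv, rfl⟩

/-- The halfspaces that contain exactly one of `x`, `y`. -/
def _root_.SimpleGraph.separators (G : SimpleGraph V) (r x y : V) : Set (Set V) :=
  {S ∈ G.halfspaces r | ¬ (x ∈ S ↔ y ∈ S)}

/-- A halfspace is determined by any edge leaving it. Of the two halfspaces of the edge xy only the
one on the side away from r avoids r. -/
theorem existsUnique_separator (hG : G.IsMedianGraph) (r : V) {x y : V} (h : G.Adj x y) :
    ∃ T, G.separators r x y = {T} ∧ (T = G.halfspace x y ∨ T = G.halfspace y x) := by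
  have key : ∀ {x y : V}, G.Adj x y → G.dist r y < G.dist r x →
      G.separators r x y = {G.halfspace x y} := by
    intro x y h hr
    ext S
    simp only [separators, Set.mem_ofPred_eq, Set.mem_singleton_iff]
    constructor
    · rintro ⟨hS, hsep⟩
      by_cases hx : x ∈ S
      · exact hG.eq_halfspace hS h hx (by tauto)
      · have hy : y ∈ S := by tauto
        have := hG.eq_halfspace hS h.symm hy hx
        subst this
        exact absurd hr hS.1
    · rintro rfl
      refine ⟨halfspace_mem_halfspaces h hr, ?_⟩
      have h1 := left_mem_halfspace h
      have h2 := right_notMem_halfspace (G := G) (u := x) (v := y)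
      tauto
  rcases hG.dist_adj h r with h1 | h1
  · exact ⟨_, key h (by omega), .inl rfl⟩
  · refine ⟨_, ?_, .inr rfl⟩
    rw [← key h.symm (by omega)]
    ext S
    simp only [separators, Set.mem_ofPred_eq]
    tauto

/-- Moving from x to a neighbour x' nearer to y crosses one halfspace T. As y is closer to x' than
to x, it lies on the same side of T as x', so exactly T disappears from the separators. -/
theorem dist_eq_ncard_separators [Finite V] (hG : G.IsMedianGraph) (r x y : V) :
    G.dist x y = (G.separators r x y).ncard := by
  induction hk : G.dist x y generalizing x with
  | zero =>
    have : x = y := hG.connected.dist_eq_zero_iff.1 hk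
    subst this
    simp [separators]
  | succ k ih =>
    obtain ⟨x', hx, hx'⟩ := hG.connected.exists_adj_dist_eq hk
    obtain ⟨T, hT, hTx⟩ := hG.existsUnique_separator r hx
    have hmem : T ∈ G.separators r x x' := by rw [hT]; rfl
    have hother : ∀ S ∈ G.halfspaces r, S ≠ T → (x ∈ S ↔ x' ∈ S) := by
      intro S hS hne
      by_contra hcon
      exact hne (by simpa [hT] using (show S ∈ G.separators r x x' from ⟨hS, hcon⟩))
    have hd := G.dist_comm (u := x) (v := y)
    have hd' := G.dist_comm (u := x') (v := y)
    have hyT : x' ∈ T ↔ y ∈ T := by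
      rcases hTx with rfl | rfl
      · have h1 := right_notMem_halfspace (G := G) (u := x) (v := x')
        have h2 : y ∉ G.halfspace x x' := by rw [mem_halfspace]; omega
        tauto
      · have h1 := left_mem_halfspace hx.symm
        have h2 : y ∈ G.halfspace x' x := by rw [mem_halfspace]; omega
        tauto
    have hins : G.separators r x y = insert T (G.separators r x' y) := by
      ext S
      simp only [Set.mem_insert_iff, separators, Set.mem_ofPred_eq]
      by_cases hST : S = T
      · subst hST
        have := hmem.2
        have := hmem.1
        tauto
      · constructor
        · rintro ⟨hS, h⟩
          have := hother S hS hST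
          tauto
        · rintro (h | ⟨hS, h⟩)
          · exact absurd h hST
          · have := hother S hS hST
            tauto
    rw [hins, Set.ncard_insert_of_notMem (fun h => h.2 hyT) (Set.toFinite _), ih x' hx']

/-- Each separator of x and y separates x from z or z from y. The numbers of separators are
distances and add up exactly, which leaves no room for an overlap. -/
theorem disjoint_separators [Finite V] (hG : G.IsMedianGraph) (r : V) {x y z : V}
    (h : G.dist x z + G.dist z y = G.dist x y) :
    Disjoint (G.separators r x z) (G.separators r z y) := by
  rw [hG.dist_eq_ncard_separators r, hG.dist_eq_ncard_separators r,
    hG.dist_eq_ncard_separators r] at h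
  have hsub : G.separators r x y ⊆ G.separators r x z ∪ G.separators r z y := by
    intro S
    simp only [separators, Set.mem_union, Set.mem_ofPred_eq]
    tauto
  have h1 := Set.ncard_le_ncard hsub (Set.toFinite _)
  have h2 := Set.ncard_union_add_ncard_inter (G.separators r x z) (G.separators r z y)
    (Set.toFinite _) (Set.toFinite _)
  rw [Set.disjoint_iff_inter_eq_empty]
  exact (Set.ncard_eq_zero (Set.toFinite _)).1 (by omega)

/-- Halfspaces are convex, and so are their complements. -/
theorem mem_iff_of_between [Finite V] (hG : G.IsMedianGraph) {r : V} {S : Set V}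
    (hS : S ∈ G.halfspaces r) {x y z : V} (h : G.dist x z + G.dist z y = G.dist x y)
    (hxy : x ∈ S ↔ y ∈ S) : z ∈ S ↔ x ∈ S := by
  by_contra hcon
  exact Set.disjoint_left.1 (hG.disjoint_separators r h)
    (show S ∈ G.separators r x z from ⟨hS, by tauto⟩)
    (show S ∈ G.separators r z y from ⟨hS, by tauto⟩)

end IsMedianGraph

end SimpleGraph

/-- Passes from unordered to ordered pairs: an unordered pair collects the contributions of its two
orders, and the diagonal contributes nothing. -/
theorem Sym2.sum_lift_add {V M : Type*} [Fintype V] [DecidableEq V] [AddCommMonoid M]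
    (h F : V → V → M) (hsymm : ∀ u v, h u v = h v u) (hF : ∀ u v, h u v = F u v + F v u)
    (hdiag : ∀ u, F u u = 0) :
    ∑ e : Sym2 V, Sym2.lift ⟨h, hsymm⟩ e = ∑ u, ∑ v, F u v := by
  rw [← Fintype.sum_prod_type', ← Finset.sum_fiberwise (Finset.univ : Finset (V × V))
    (fun p => s(p.1, p.2))]
  refine Finset.sum_congr rfl fun e _ => ?_
  induction e using Sym2.ind with
  | _ a b =>
    have hfil : (Finset.univ.filter fun p : V × V => s(p.1, p.2) = s(a, b)) =
        {(a, b), (b, a)} := by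
      ext ⟨x, y⟩
      simp
    rw [hfil, Sym2.lift_mk]
    by_cases hab : a = b
    · subst hab
      simp [hF, hdiag]
    · rw [Finset.sum_pair (by simp [Prod.ext_iff, hab])]
      exact hF a b

/-! ### Θ-classes as cuts of halfspaces, and the sum formula. -/

namespace SimpleGraph

variable {V : Type*} {G : SimpleGraph V}

/-- The edges with exactly one end in `S`. -/
def cutEdges (G : SimpleGraph V) (S : Set V) : Set (Sym2 V) :=
  {e | ∃ x y, G.Adj x y ∧ x ∈ S ∧ y ∉ S ∧ e = s(x, y)}

namespace IsMedianGraph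

theorem wienerIndex_eq_sum [Fintype V] [DecidableEq V] (hG : G.IsMedianGraph) (w : V → ℝ)
    (r : V) : G.wienerIndex w =
      ∑ᶠ S ∈ G.halfspaces r, setWeight w S * setWeight w Sᶜ := by
  classical
  have hfin := Set.toFinite (G.halfspaces r)
  rw [finsum_mem_eq_finite_toFinset_sum _ hfin]
  -- An ordered pair (u, v) is charged to S when u is inside and v outside; a separator of an
  -- unordered pair is thus charged in exactly one of its two orders.
  rw [wienerIndex, Sym2.sum_lift_add _
    (fun u v => ∑ S ∈ hfin.toFinset, S.indicator w u * Sᶜ.indicator w v)]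
  · simp only [setWeight, Finset.sum_mul_sum]
    rw [Finset.sum_comm]
    refine (Finset.sum_congr rfl fun v _ => Finset.sum_comm).trans ?_
    rw [Finset.sum_comm]
    exact Finset.sum_congr rfl fun S _ => Finset.sum_comm
  · intro u v
    have hd : (G.dist u v : ℝ) =
        ∑ S ∈ hfin.toFinset, if (u ∈ S ↔ v ∈ S) then (0 : ℝ) else 1 := by
      have : G.separators r u v =
          (hfin.toFinset.filter fun S => ¬ (u ∈ S ↔ v ∈ S) : Finset (Set V)) := by
        ext S
        simp [separators]
      rw [hG.dist_eq_ncard_separators r, this, Set.ncard_coe_finset, Finset.card_filter]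
      push_cast
      exact Finset.sum_congr rfl fun S _ => by split_ifs <;> simp_all
    rw [hd, Finset.mul_sum, ← Finset.sum_add_distrib]
    refine Finset.sum_congr rfl fun S _ => ?_
    by_cases hu : u ∈ S <;> by_cases hv : v ∈ S <;> simp [hu, hv, mul_comm]
  · intro u
    refine Finset.sum_eq_zero fun S _ => ?_
    by_cases hu : u ∈ S <;> simp [hu]

theorem cutEdges_halfspace (hG : G.IsMedianGraph) {u v : V} (huv : G.Adj u v) :
    G.cutEdges (G.halfspace u v) =
      {e | Relation.ReflTransGen G.OppositeInSquare s(u, v) e} := by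
  ext e
  constructor
  · rintro ⟨x, y, hxy, hx, hy, rfl⟩
    rw [← Set.mem_compl_iff, hG.compl_halfspace huv] at hy
    exact (hG.halfspace_eq_and_reflTransGen huv _ hxy hx hy rfl).2
  · intro h
    have h' : Relation.ReflTransGen G.OppositeInSquare s(u, v) e := h
    clear h
    induction h' with
    | refl => exact ⟨u, v, huv, left_mem_halfspace huv, right_notMem_halfspace, rfl⟩
    | tail _ hopp ih =>
      obtain ⟨x, y, hxy, hx, hy, he⟩ := ih
      obtain ⟨a, b, a', b', rfl, rfl, h1, h2, h3, h4, h5, h6⟩ := hopp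
      have hS := hG.halfspace_eq_of_adj huv hxy hx hy
      rcases Sym2.eq_iff.1 he with ⟨rfl, rfl⟩ | ⟨rfl, rfl⟩
      · rw [← hS, hG.halfspace_eq_of_square h1 h2 h3 h4 h5 h6]
        exact ⟨a', b', h3.symm, left_mem_halfspace h3.symm, right_notMem_halfspace, rfl⟩
      · rw [← hS, hG.halfspace_eq_of_square h1.symm h4.symm h3.symm h2.symm h6 h5]
        exact ⟨b', a', h3, left_mem_halfspace h3, right_notMem_halfspace, Sym2.eq_swap⟩

theorem cutEdges_compl (S : Set V) : G.cutEdges Sᶜ = G.cutEdges S := by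
  ext e
  constructor
  · rintro ⟨x, y, hxy, hx, hy, rfl⟩
    exact ⟨y, x, hxy.symm, not_not.1 hy, hx, Sym2.eq_swap⟩
  · rintro ⟨x, y, hxy, hx, hy, rfl⟩
    exact ⟨y, x, hxy.symm, hy, not_not.2 hx, Sym2.eq_swap⟩

/-- A halfspace and its complement have the same cut, and one of the two avoids r. -/
theorem thetaClasses_eq_image (hG : G.IsMedianGraph) (r : V) :
    G.thetaClasses = G.cutEdges '' G.halfspaces r := by
  ext E
  constructor
  · rintro ⟨e, he, rfl⟩
    induction e using Sym2.ind with
    | _ a b =>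
      have hab : G.Adj a b := he
      by_cases hr : r ∈ G.halfspace a b
      · have hr' : G.dist r a < G.dist r b := hr
        refine ⟨_, halfspace_mem_halfspaces hab.symm hr', ?_⟩
        rw [← hG.compl_halfspace hab, cutEdges_compl, hG.cutEdges_halfspace hab]
      · exact ⟨_, ⟨hr, a, b, hab, rfl⟩, hG.cutEdges_halfspace hab⟩
  · rintro ⟨_, ⟨_, u, v, huv, rfl⟩, rfl⟩
    exact ⟨s(u, v), huv, hG.cutEdges_halfspace huv⟩

/-- An edge of the cut determines the halfspace up to complementation, and avoiding r decides
between the two sides. -/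
theorem injOn_cutEdges (hG : G.IsMedianGraph) (r : V) :
    Set.InjOn G.cutEdges (G.halfspaces r) := by
  intro S hS T hT h
  obtain ⟨hrS, u, v, huv, rfl⟩ := hS
  have : s(u, v) ∈ G.cutEdges (G.halfspace u v) :=
    ⟨u, v, huv, left_mem_halfspace huv, right_notMem_halfspace, rfl⟩
  rw [h] at this
  obtain ⟨x, y, hxy, hx, hy, he⟩ := this
  rcases Sym2.eq_iff.1 he with ⟨rfl, rfl⟩ | ⟨rfl, rfl⟩
  · exact (hG.eq_halfspace hT hxy hx hy).symm
  · have hTe := hG.eq_halfspace hT hxy hx hy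
    have := hT.1
    rw [hTe, ← hG.compl_halfspace huv] at this
    exact absurd hrS this

/-- A shortest path from x to u never leaves the halfspace: each step lowers the distance to u by
one and the distance to v by at most one. -/
theorem reachable_deleteEdges_cutEdges (hG : G.IsMedianGraph) {u v : V} (huv : G.Adj u v) (k : ℕ) :
    ∀ {x : V}, x ∈ G.halfspace u v → G.dist x u = k →
      (G.deleteEdges (G.cutEdges (G.halfspace u v))).Reachable x u := by
  induction k with
  | zero =>
    intro x _ hk
    rw [hG.connected.dist_eq_zero_iff.1 hk]
  | succ k ih =>
    intro x hx hk
    obtain ⟨y, hxy, hy⟩ := hG.connected.exists_adj_dist_eq hk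
    have hyS : y ∈ G.halfspace u v := by
      rw [mem_halfspace] at hx ⊢
      have h1 := hG.dist_adj huv x
      have h2 := hG.dist_adj hxy v
      simp only [G.dist_comm (u := v)] at h2
      omega
    refine Reachable.trans (Adj.reachable ?_) (ih hyS hy)
    rw [deleteEdges_adj]
    refine ⟨hxy, ?_⟩
    rintro ⟨a, b, _, ha, hb, he⟩
    rcases Sym2.eq_iff.1 he with ⟨rfl, rfl⟩ | ⟨rfl, rfl⟩
    · exact hb hyS
    · exact hb hx

theorem reachable_deleteEdges_cutEdges_iff (hG : G.IsMedianGraph) {u v : V} (huv : G.Adj u v)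
    (x : V) :
    (G.deleteEdges (G.cutEdges (G.halfspace u v))).Reachable x u ↔ x ∈ G.halfspace u v := by
  refine ⟨?_, fun h => hG.reachable_deleteEdges_cutEdges huv _ h rfl⟩
  have key : ∀ {S : Set V} {a b : V}, (G.deleteEdges (G.cutEdges S)).Walk a b → b ∈ S → a ∈ S := by
    intro S a b p hb
    induction p with
    | nil => exact hb
    | @cons a b c h p ih =>
      by_contra ha
      rw [deleteEdges_adj] at h
      exact h.2 ⟨b, a, h.1.symm, ih hb, ha, Sym2.eq_swap⟩
  rintro ⟨p⟩
  exact key p (left_mem_halfspace huv)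

theorem areTheTwoComponents (hG : G.IsMedianGraph) {r : V} {S : Set V}
    (hS : S ∈ G.halfspaces r) : G.AreTheTwoComponents (G.cutEdges S) S Sᶜ := by
  obtain ⟨hr, u, v, huv, rfl⟩ := hS
  have h1 := hG.reachable_deleteEdges_cutEdges_iff huv
  have h2 := hG.reachable_deleteEdges_cutEdges_iff huv.symm
  rw [← hG.compl_halfspace huv, cutEdges_compl] at h2
  have e1 : ((G.deleteEdges (G.cutEdges (G.halfspace u v))).connectedComponentMk u).supp =
      G.halfspace u v := by
    ext x
    rw [ConnectedComponent.mem_supp_iff, ConnectedComponent.eq, h1]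
  have e2 : ((G.deleteEdges (G.cutEdges (G.halfspace u v))).connectedComponentMk v).supp =
      (G.halfspace u v)ᶜ := by
    ext x
    rw [ConnectedComponent.mem_supp_iff, ConnectedComponent.eq, h2]
  refine ⟨fun h => ?_, ?_⟩
  · have := left_mem_halfspace huv
    rw [h] at this
    exact this (left_mem_halfspace huv)
  · ext T
    constructor
    · rintro ⟨c, rfl⟩
      induction c using ConnectedComponent.ind with
      | _ x =>
        by_cases hx : x ∈ G.halfspace u v
        · left
          exact (congrArg ConnectedComponent.supp (ConnectedComponent.eq.2 ((h1 x).2 hx))).trans e1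
        · right
          exact (congrArg ConnectedComponent.supp (ConnectedComponent.eq.2 ((h2 x).2 hx))).trans e2
    · rintro (rfl | rfl)
      · exact ⟨_, e1.symm⟩
      · exact ⟨_, e2.symm⟩

/-- The weighted Wiener index of a median graph as a sum over the Θ-classes. -/
theorem exists_components_wienerIndex_eq [Fintype V] [DecidableEq V] (hG : G.IsMedianGraph)
    (w : V → ℝ) :
    ∃ H' H'' : Set (Sym2 V) → Set V,
      (∀ E ∈ G.thetaClasses, G.AreTheTwoComponents E (H' E) (H'' E)) ∧
      G.wienerIndex w = ∑ᶠ E ∈ G.thetaClasses, setWeight w (H' E) * setWeight w (H'' E) := by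
  obtain ⟨r⟩ := hG.connected.nonempty
  have hinv := (hG.injOn_cutEdges r).leftInvOn_invFunOn
  refine ⟨Function.invFunOn G.cutEdges (G.halfspaces r),
    fun E => (Function.invFunOn G.cutEdges (G.halfspaces r) E)ᶜ, ?_, ?_⟩
  · rw [hG.thetaClasses_eq_image r]
    rintro _ ⟨S, hS, rfl⟩
    simp only [hinv hS]
    exact hG.areTheTwoComponents hS
  · rw [hG.thetaClasses_eq_image r, finsum_mem_image (hG.injOn_cutEdges r),
      hG.wienerIndex_eq_sum w r]
    exact finsum_mem_congr rfl fun S hS => by simp only [hinv hS]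

end IsMedianGraph

end SimpleGraph

/-! ### Gates and labels for a numbering by distance from the root. -/

namespace SimpleGraph

variable {V : Type*} {G : SimpleGraph V}

/-- The vertices are numbered injectively in an order of nondecreasing distance from `r`. -/
structure IsDistanceNumbering (G : SimpleGraph V) (r : V) (pos : V → ℕ) : Prop where
  injective : Function.Injective pos
  dist_le : ∀ u v, pos u < pos v → G.dist r u ≤ G.dist r v

/-- The least number of a vertex of `S`. -/
noncomputable def firstPos (pos : V → ℕ) (S : Set V) : ℕ := sInf (pos '' S)

theorem firstPos_le {pos : V → ℕ} {S : Set V} {x : V} (hx : x ∈ S) : firstPos pos S ≤ pos x :=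
  Nat.sInf_le ⟨x, hx, rfl⟩

namespace IsMedianGraph

theorem exists_pos_eq_firstPos {r : V} {S : Set V} (hS : S ∈ G.halfspaces r) (pos : V → ℕ) :
    ∃ g ∈ S, pos g = firstPos pos S := by
  obtain ⟨_, u, v, huv, rfl⟩ := hS
  exact Nat.sInf_mem (s := pos '' G.halfspace u v) ⟨_, u, left_mem_halfspace huv, rfl⟩

section Numbering

variable {r : V} {pos : V → ℕ}

theorem dist_eq_of_pos_lt (hG : G.IsMedianGraph) (hp : G.IsDistanceNumbering r pos) {u v : V}
    (h : G.Adj v u) (huv : pos u < pos v) : G.dist r v = G.dist r u + 1 := by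
  have h1 := hG.dist_adj h r
  have h2 := hp.dist_le u v huv
  omega

theorem pos_lt_of_dist_lt (hp : G.IsDistanceNumbering r pos) {u v : V}
    (h : G.dist r u < G.dist r v) : pos u < pos v := by
  by_contra hcon
  rcases (not_lt.1 hcon).lt_or_eq with h1 | h1
  · have := hp.dist_le v u h1
    omega
  · rw [hp.injective h1] at h
    omega

theorem exists_adj_pos_lt (hG : G.IsMedianGraph) (hp : G.IsDistanceNumbering r pos) {v : V}
    (hv : v ≠ r) : ∃ u, G.Adj v u ∧ pos u < pos v := by
  obtain ⟨k, hk⟩ := Nat.exists_eq_succ_of_ne_zero (hG.connected.pos_dist_of_ne hv).ne'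
  obtain ⟨u, hu, hd⟩ := hG.connected.exists_adj_dist_eq hk
  refine ⟨u, hu, pos_lt_of_dist_lt hp ?_⟩
  rw [G.dist_comm (v := u), G.dist_comm (v := v)]
  omega

theorem halfspace_mem_of_pos_lt (hG : G.IsMedianGraph) (hp : G.IsDistanceNumbering r pos)
    {u v : V} (h : G.Adj v u) (huv : pos u < pos v) : G.halfspace v u ∈ G.halfspaces r :=
  halfspace_mem_halfspaces h (by rw [hG.dist_eq_of_pos_lt hp h huv]; omega)

/-- Stepping away from r never leaves a halfspace avoiding r: a halfspace left along u to v would be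
the one of the vertices closer to u, which contains r. -/
theorem mem_iff_of_pos_lt (hG : G.IsMedianGraph) (hp : G.IsDistanceNumbering r pos) {u v : V}
    (h : G.Adj v u) (huv : pos u < pos v) {T : Set V} (hT : T ∈ G.halfspaces r) :
    v ∈ T ↔ u ∈ T ∨ T = G.halfspace v u := by
  constructor
  · intro hv
    by_cases hu : u ∈ T
    · exact .inl hu
    · exact .inr (hG.eq_halfspace hT h hv hu)
  · rintro (hu | rfl)
    · by_contra hv
      have := hG.eq_halfspace hT h.symm hu hv
      subst this
      have h1 := hG.dist_eq_of_pos_lt hp h huv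
      exact hT.1 (by rw [mem_halfspace]; omega)
    · exact left_mem_halfspace h

/-- The first vertex of a halfspace is the gate of `r` in it. -/
theorem dist_add_dist_gate [Finite V] (hG : G.IsMedianGraph) (hp : G.IsDistanceNumbering r pos)
    {S : Set V} (hS : S ∈ G.halfspaces r) {g x : V} (hg : g ∈ S) (hgp : pos g = firstPos pos S)
    (hx : x ∈ S) : G.dist r g + G.dist g x = G.dist r x := by
  -- By convexity m lies in S, and it is no farther from r than g. Since g comes first in S, m = g.
  obtain ⟨m, h1, h2, h3⟩ := hG.exists_median r g x
  have hm : m ∈ S := (hG.mem_iff_of_between hS h2 (by tauto)).2 hg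
  have h4 : G.dist r g ≤ G.dist r m := by
    by_contra hcon
    have h5 := pos_lt_of_dist_lt hp (not_le.1 hcon)
    have h6 := firstPos_le (pos := pos) hm
    omega
  have : m = g := hG.connected.dist_eq_zero_iff.1 (by omega)
  subst this
  rw [G.dist_comm (u := r) (v := m), G.dist_comm (u := r) (v := x), G.dist_comm (v := x)]
  omega

/-- The gate has an earlier neighbour, which must lie outside the halfspace, and this edge
determines the halfspace. So the number of the gate can serve as a name. -/
theorem injOn_firstPos (hG : G.IsMedianGraph) (hp : G.IsDistanceNumbering r pos) :
    Set.InjOn (firstPos pos) (G.halfspaces r) := by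
  intro S hS T hT h
  obtain ⟨g, hg, hgp⟩ := exists_pos_eq_firstPos hS pos
  obtain ⟨g', hg', hgp'⟩ := exists_pos_eq_firstPos hT pos
  have : g = g' := hp.injective (by omega)
  subst this
  have hgr : g ≠ r := by rintro rfl; exact hS.1 hg
  obtain ⟨u, hu, hup⟩ := hG.exists_adj_pos_lt hp hgr
  have h1 : u ∉ S := fun hc => by have := firstPos_le (pos := pos) hc; omega
  have h2 : u ∉ T := fun hc => by have := firstPos_le (pos := pos) hc; omega
  rw [hG.eq_halfspace hS hu hg h1, hG.eq_halfspace hT hu hg' h2]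

/-- Among the halfspaces containing `v`, the one which is met last is entered by an edge from an
earlier neighbour of `v` to `v`. -/
theorem exists_adj_notMem [Finite V] (hG : G.IsMedianGraph) (hp : G.IsDistanceNumbering r pos)
    {S : Set V} (hS : S ∈ G.halfspaces r) {g : V} (hg : g ∈ S) (hgp : pos g = firstPos pos S)
    (k : ℕ) : ∀ {v : V}, v ∈ S → G.dist v g = k →
      (∀ T ∈ G.halfspaces r, v ∈ T → firstPos pos T ≤ firstPos pos S) →
      ∃ u, G.Adj v u ∧ pos u < pos v ∧ u ∉ S := by
  induction k with
  | zero =>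
    intro v hv hk _
    have : v = g := hG.connected.dist_eq_zero_iff.1 hk
    subst this
    have hgr : v ≠ r := by rintro rfl; exact hS.1 hg
    obtain ⟨u, hu, hup⟩ := hG.exists_adj_pos_lt hp hgr
    exact ⟨u, hu, hup, fun hc => by have := firstPos_le (pos := pos) hc; omega⟩
  | succ k ih =>
    intro v hv hk hmax
    obtain ⟨u, hvu, huk⟩ := hG.connected.exists_adj_dist_eq hk
    have hd1 := dist_eq_one_iff_adj.2 hvu
    have huS : u ∈ S := (hG.mem_iff_of_between hS (x := v) (y := g) (by omega) (by tauto)).2 hv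
    have e1 := hG.dist_add_dist_gate hp hS hg hgp hv
    have e2 := hG.dist_add_dist_gate hp hS hg hgp huS
    rw [G.dist_comm (u := g)] at e1 e2
    have hpu : pos u < pos v := pos_lt_of_dist_lt hp (by omega)
    obtain ⟨t, hut, hpt, htS⟩ := ih huS huk fun T hT huT =>
      hmax T hT ((hG.mem_iff_of_pos_lt hp hvu hpu hT).2 (.inl huT))
    -- `S'` contains v but not u, so it differs from S and its gate comes before that of S. Hence
    -- the gate g' of `S'` lies outside S.
    have hS' := hG.halfspace_mem_of_pos_lt hp hvu hpu
    set S' := G.halfspace v u with hS'def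
    have hvS' : v ∈ S' := left_mem_halfspace hvu
    have huS' : u ∉ S' := right_notMem_halfspace
    have htS' : t ∉ S' := fun hc => huS' ((hG.mem_iff_of_pos_lt hp hut hpt hS').2 (.inl hc))
    obtain ⟨g', hg', hgp'⟩ := exists_pos_eq_firstPos hS' pos
    have hle := hmax S' hS' hvS'
    have hne : firstPos pos S' ≠ firstPos pos S := fun hc =>
      huS' (hG.injOn_firstPos hp hS' hS hc ▸ huS)
    have hg'S : g' ∉ S := fun hc => by have := firstPos_le (pos := pos) hc; omega
    -- By convexity m is outside S, like t and g', and inside `S'`, like v and g'. So it differs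
    -- from v and t, which are at distance 2, and is a common neighbour of theirs one layer below v.
    obtain ⟨m, h1, h2, h3⟩ := hG.exists_median v t g'
    have hmS : m ∉ S := fun hc => htS ((hG.mem_iff_of_between hS h2 (by tauto)).1 hc)
    have hmS' : m ∈ S' := (hG.mem_iff_of_between hS' h3 (by tauto)).2 hg'
    have hvt : v ≠ t := by rintro rfl; exact htS hv
    have h4 := hG.dist_eq_two hvu hut hvt
    have h5 := hG.connected.pos_dist_of_ne (show v ≠ m by rintro rfl; exact hmS hv)
    have h6 := hG.connected.pos_dist_of_ne (show m ≠ t by rintro rfl; exact htS' hmS')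
    have hvm : G.Adj v m := dist_eq_one_iff_adj.1 (by omega)
    have htm : G.Adj t m := (dist_eq_one_iff_adj.1 (by omega)).symm
    refine ⟨m, hvm, pos_lt_of_dist_lt hp ?_, hmS⟩
    have h7 := hG.dist_eq_of_pos_lt hp hvu hpu
    have h8 := hG.dist_eq_of_pos_lt hp hut hpt
    have h9 := hG.dist_adj htm r
    omega

/-- The labels `c` and the parents `p` are computed from the numbering as follows: the parent of
`v` is an earlier neighbour with least label, and `v` gets the largest label of an
earlier neighbour, or a new label if all earlier neighbours have the same label. -/
structure _root_.SimpleGraph.IsLabelling (G : SimpleGraph V) (r : V) (pos c : V → ℕ) (p : V → V) :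
    Prop where
  root : c r = 0
  adj : ∀ v, v ≠ r → G.Adj v (p v)
  pos_lt : ∀ v, v ≠ r → pos (p v) < pos v
  le : ∀ v, v ≠ r → ∀ u, G.Adj v u → pos u < pos v → c (p v) ≤ c u
  eq : ∀ v, v ≠ r → ∃ u, G.Adj v u ∧ pos u < pos v ∧
    (∀ u', G.Adj v u' → pos u' < pos v → c u' ≤ c u) ∧ c v = if c u = c (p v) then pos v else c u

variable {c : V → ℕ} {p : V → V}

theorem firstPos_pos (hG : G.IsMedianGraph) (hp : G.IsDistanceNumbering r pos) {S : Set V}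
    (hS : S ∈ G.halfspaces r) : pos r < firstPos pos S := by
  obtain ⟨g, hg, hgp⟩ := exists_pos_eq_firstPos hS pos
  have hgr : r ≠ g := by rintro rfl; exact hS.1 hg
  rw [← hgp]
  apply pos_lt_of_dist_lt hp
  rw [dist_self]
  exact hG.connected.pos_dist_of_ne hgr

/-- Together the two claims say that the label of v is the largest gate number among the halfspaces
containing v, and that the edge to the parent leaves exactly that halfspace S. By induction, earlier
neighbours in S have label `firstPos pos S`, and the only neighbour of v outside S has a smaller
label. -/
theorem label_spec [Finite V] (hG : G.IsMedianGraph) (hp : G.IsDistanceNumbering r pos)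
    (hc : G.IsLabelling r pos c p) (k : ℕ) : ∀ v, pos v = k →
      (∀ T ∈ G.halfspaces r, v ∈ T → firstPos pos T ≤ c v) ∧
      (v ≠ r → firstPos pos (G.halfspace v (p v)) = c v) := by
  induction k using Nat.strong_induction_on with
  | _ k ih =>
  intro v hvk
  by_cases hvr : v = r
  · subst hvr
    exact ⟨fun T hT hv => absurd hv hT.1, fun h => absurd rfl h⟩
  have hadj := hc.adj v hvr
  have hlt := hc.pos_lt v hvr
  have hne : {T ∈ G.halfspaces r | v ∈ T}.Nonempty :=
    ⟨_, hG.halfspace_mem_of_pos_lt hp hadj hlt, left_mem_halfspace hadj⟩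
  obtain ⟨S, ⟨hS, hvS⟩, hmax⟩ := Set.exists_max_image _ (firstPos pos) (Set.toFinite _) hne
  have hmax : ∀ T ∈ G.halfspaces r, v ∈ T → firstPos pos T ≤ firstPos pos S :=
    fun T hT hv => hmax T ⟨hT, hv⟩
  obtain ⟨g, hg, hgp⟩ := exists_pos_eq_firstPos hS pos
  obtain ⟨u₀, hu₀, hpu₀, hu₀S⟩ := hG.exists_adj_notMem hp hS hg hgp _ hvS rfl hmax
  have hSe := hG.eq_halfspace hS hu₀ hvS hu₀S
  -- A second neighbour u outside S would give S = `G.halfspace v u`, which contains `u₀`: it is at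
  -- distance 1 from v and 2 from u.
  have hother : ∀ u, G.Adj v u → u ≠ u₀ → u ∈ S := by
    intro u hu hne
    by_contra huS
    have h1 := hG.eq_halfspace hS hu hvS huS
    apply hu₀S
    rw [h1, mem_halfspace, dist_eq_one_iff_adj.2 hu₀.symm, hG.dist_eq_two hu₀.symm hu hne.symm]
    omega
  have hpar : ∀ u, G.Adj v u → pos u < pos v → u ≠ r →
      G.halfspace u (p u) ∈ G.halfspaces r ∧ u ∈ G.halfspace u (p u) ∧
      firstPos pos (G.halfspace u (p u)) = c u ∧ c u ≤ firstPos pos S := by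
    intro u hu hpu hur
    have h1 := hG.halfspace_mem_of_pos_lt hp (hc.adj u hur) (hc.pos_lt u hur)
    have h2 := left_mem_halfspace (hc.adj u hur)
    have h3 := (ih _ (hvk ▸ hpu) u rfl).2 hur
    refine ⟨h1, h2, h3, h3 ▸ hmax _ h1 ((hG.mem_iff_of_pos_lt hp hu hpu h1).2 (.inl h2))⟩
  have hA : ∀ u, G.Adj v u → pos u < pos v → u ≠ u₀ → c u = firstPos pos S := by
    intro u hu hpu hne
    have huS := hother u hu hne
    have hur : u ≠ r := by rintro rfl; exact hS.1 huS
    exact le_antisymm (hpar u hu hpu hur).2.2.2 ((ih _ (hvk ▸ hpu) u rfl).1 S hS huS)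
  have hB : c u₀ < firstPos pos S := by
    by_cases hur : u₀ = r
    · rw [hur, hc.root]
      have := hG.firstPos_pos hp hS
      omega
    · obtain ⟨h1, h2, h3, h4⟩ := hpar u₀ hu₀ hpu₀ hur
      refine lt_of_le_of_ne h4 fun h => hu₀S ?_
      rw [← h3] at h
      rwa [← hG.injOn_firstPos hp h1 hS h]
  have hpv : p v = u₀ := by
    by_contra hne
    have h1 := hA _ hadj hlt hne
    have h2 := hc.le v hvr u₀ hu₀ hpu₀
    omega
  have hcv : c v = firstPos pos S := by
    obtain ⟨u₁, hu₁, hpu₁, hle, hcv⟩ := hc.eq v hvr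
    rw [hpv] at hcv
    by_cases h01 : u₁ = u₀
    · rw [h01, if_pos rfl] at hcv
      -- Otherwise the neighbour of v towards the gate would be an earlier neighbour in S, with a
      -- label larger than that of `u₀`. So equal labels mean that v is itself the gate and S is
      -- new.
      have hgv : g = v := by
        by_contra hgv
        obtain ⟨k, hk⟩ := Nat.exists_eq_succ_of_ne_zero
          (hG.connected.pos_dist_of_ne (Ne.symm hgv)).ne'
        obtain ⟨y, hvy, hyk⟩ := hG.connected.exists_adj_dist_eq hk
        have hd1 := dist_eq_one_iff_adj.2 hvy
        have hyS : y ∈ S :=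
          (hG.mem_iff_of_between hS (x := v) (y := g) (by omega) (by tauto)).2 hvS
        have e1 := hG.dist_add_dist_gate hp hS hg hgp hvS
        have e2 := hG.dist_add_dist_gate hp hS hg hgp hyS
        rw [G.dist_comm (u := g)] at e1 e2
        have hpy : pos y < pos v := pos_lt_of_dist_lt hp (by omega)
        have hy0 : y ≠ u₀ := by rintro rfl; exact hu₀S hyS
        have h1 := hA y hvy hpy hy0
        have h2 := hle y hvy hpy
        rw [h01] at h2
        omega
      rw [hcv, ← hgp, hgv]
    · have h1 := hA u₁ hu₁ hpu₁ h01
      rw [if_neg (by omega)] at hcv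
      omega
  rw [hcv]
  exact ⟨hmax, fun _ => by rw [hpv, ← hSe]⟩

theorem firstPos_parent [Finite V] (hG : G.IsMedianGraph) (hp : G.IsDistanceNumbering r pos)
    (hc : G.IsLabelling r pos c p) {v : V} (hv : v ≠ r) :
    firstPos pos (G.halfspace v (p v)) = c v :=
  (hG.label_spec hp hc _ v rfl).2 hv

theorem label_le [Finite V] (hG : G.IsMedianGraph) (hp : G.IsDistanceNumbering r pos)
    (hc : G.IsLabelling r pos c p) {v : V} (hv : v ≠ r) : c v ≤ pos v := by
  rw [← hG.firstPos_parent hp hc hv]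
  exact firstPos_le (left_mem_halfspace (hc.adj v hv))

end Numbering

end IsMedianGraph

end SimpleGraph

/-! ### Invariants of the labelling breadth-first search. -/

namespace SimpleGraph

variable {n : ℕ}

/-- `u` is a neighbour of `v` which has been numbered before `v`; unnumbered vertices have the
number `0`. -/
def IsEarlier (G : SimpleGraph (Fin n)) (pos : ℕ → ℕ) (v u : Fin n) : Prop :=
  G.Adj v u ∧ pos u ≠ 0 ∧ pos u < pos v

/-- The label `m` and the parent `a` of `v` fit to the labels of the earlier neighbours. -/
def LabelSpec (G : SimpleGraph (Fin n)) (pos c : ℕ → ℕ) (v : Fin n) (m a : ℕ) : Prop :=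
  ∃ x y : Fin n, a = x ∧ G.IsEarlier pos v x ∧ G.IsEarlier pos v y ∧
    (∀ u, G.IsEarlier pos v u → c x ≤ c u ∧ c u ≤ c y) ∧ m = if c y = c x then pos v else c y

theorem LabelSpec.congr {G : SimpleGraph (Fin n)} {pos c pos' c' : ℕ → ℕ} {v : Fin n} {m a : ℕ}
    (h : G.LabelSpec pos c v m a) (hE : ∀ u, G.IsEarlier pos' v u ↔ G.IsEarlier pos v u)
    (hv : pos' v = pos v) (hc : ∀ u, G.IsEarlier pos v u → c' u = c u) :
    G.LabelSpec pos' c' v m a := by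
  obtain ⟨x, y, ha, hx, hy, hle, hm⟩ := h
  refine ⟨x, y, ha, (hE x).2 hx, (hE y).2 hy, fun u hu => ?_, ?_⟩
  · have hu' := (hE u).1 hu
    rw [hc u hu', hc x hx, hc y hy]
    exact hle u hu'
  · rw [hc x hx, hc y hy, hv]
    exact hm

/-- The state of a breadth-first search from `r` which stores the queue at the positions
`1, …, t - 1` of `Q`, and which has dealt with the vertices before position `i` and has given
them labels `c` and parents `p`. -/
structure SearchState (G : SimpleGraph (Fin n)) (r : Fin n) (i t : ℕ) (Q pos c p : ℕ → ℕ) :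
    Prop where
  one_le : 1 ≤ i
  le : i ≤ t
  root : pos r = 1
  queue : ∀ k, 1 ≤ k → k < t → ∃ x : Fin n, Q k = x ∧ pos x = k
  pos_spec : ∀ x : Fin n, pos x ≠ 0 → pos x < t ∧ Q (pos x) = x
  mono : ∀ x y : Fin n, pos x ≠ 0 → pos x < pos y → G.dist r x ≤ G.dist r y
  near : ∀ x y : Fin n, i ≤ pos x → pos y ≠ 0 → G.dist r y ≤ G.dist r x + 1
  complete : ∀ x y : Fin n, pos x = i → G.dist r y ≤ G.dist r x → pos y ≠ 0
  closed : ∀ x y : Fin n, pos x ≠ 0 → pos x < i → G.Adj x y → pos y ≠ 0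
  root_label : 1 < i → c r = 0
  label_le : ∀ x : Fin n, pos x ≠ 0 → pos x < i → c x ≤ pos x
  label : ∀ x : Fin n, x ≠ r → pos x ≠ 0 → pos x < i → G.LabelSpec pos c x (c x) (p x)

namespace SearchState

variable {G : SimpleGraph (Fin n)} {r : Fin n} {i t : ℕ} {Q pos c p : ℕ → ℕ}

theorem pos_injective (h : G.SearchState r i t Q pos c p) {x y : Fin n} (hx : pos x ≠ 0)
    (hxy : pos x = pos y) : x = y := by
  have h1 := (h.pos_spec x hx).2
  have h2 := (h.pos_spec y (hxy ▸ hx)).2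
  rw [hxy, h2] at h1
  exact Fin.ext h1.symm

theorem le_succ (h : G.SearchState r i t Q pos c p) : t ≤ n + 1 := by
  have : (Finset.Ico 1 t).card ≤ (Finset.univ : Finset (Fin n)).card := by
    have : Nonempty (Fin n) := ⟨r⟩
    choose! f hf using h.queue
    refine Finset.card_le_card_of_injOn (fun k => if hk : 1 ≤ k ∧ k < t then f k else r)
      (fun _ _ => Finset.mem_coe.2 (Finset.mem_univ _)) ?_
    intro k hk l hl hkl
    rw [Finset.coe_Ico] at hk hl
    simp only [hk.1, hk.2, hl.1, hl.2, and_self, dite_true] at hkl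
    rw [← (hf k hk.1 hk.2).2, ← (hf l hl.1 hl.2).2, hkl]
  simp only [Nat.card_Ico, Finset.card_univ, Fintype.card_fin] at this
  omega

/-- The root is the vertex 0, so position 1 of the all-zero queue already holds it; only its number
has to be set. -/
theorem init (hG : G.Connected) (hr : (r : ℕ) = 0) :
    G.SearchState r 1 2 0 (Function.update 0 0 1) 0 0 := by
  have hpos : ∀ x : Fin n, (Function.update 0 0 1 : ℕ → ℕ) x ≠ 0 → x = r := by
    intro x hx
    by_contra hne
    apply hx
    rw [Function.update_of_ne]
    · rfl
    · rw [← hr]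
      exact fun h => hne (Fin.ext h)
  have hr1 : (Function.update 0 0 1 : ℕ → ℕ) r = 1 := by rw [hr, Function.update_self]
  constructor
  · exact le_rfl
  · omega
  · exact hr1
  · intro k h1 h2
    refine ⟨r, hr.symm, ?_⟩
    rw [hr1]
    omega
  · intro x hx
    obtain rfl := hpos x hx
    rw [hr1]
    exact ⟨by omega, hr.symm⟩
  · intro x y hx hxy
    obtain rfl := hpos x hx
    simp
  · intro x y hx hy
    obtain rfl := hpos y hy
    simp
  · intro x y hx hd
    obtain rfl := hpos x (by omega)
    rw [dist_self, Nat.le_zero, hG.dist_eq_zero_iff] at hd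
    rw [← hd]
    omega
  · intro x y hx hx'
    omega
  · intro h
    omega
  · intro x hx hx'
    omega
  · intro x _ hx hx'
    omega

/-- By `complete` the unnumbered u is farther from r than v, hence in the next layer; by `near` no
queued vertex is farther than that layer. So u may be appended at the end. -/
theorem push (h : G.SearchState r i t Q pos c p) {v u : Fin n} (hG : G.Connected)
    (hv : pos v = i) (hvu : G.Adj v u) (hu : pos u = 0) :
    G.SearchState r i (t + 1) (Function.update Q t u) (Function.update pos u t) c p := by
  have hi := h.one_le
  have hit : i < t := hv ▸ (h.pos_spec v (by omega)).1
  have hself : (Function.update pos u t : ℕ → ℕ) u = t := Function.update_self ..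
  have hne : ∀ x : Fin n, x ≠ u → (Function.update pos u t : ℕ → ℕ) x = pos x := fun x hx =>
    Function.update_of_ne (fun hc => hx (Fin.ext hc)) ..
  have hold : ∀ x : Fin n, pos x ≠ 0 → (Function.update pos u t : ℕ → ℕ) x = pos x := by
    intro x hx
    exact hne x (by rintro rfl; exact hx hu)
  have hQ : ∀ k, k < t → Function.update Q t (u : ℕ) k = Q k := fun k hk =>
    Function.update_of_ne (by omega) ..
  have hd1 : G.dist r u ≤ G.dist r v + 1 := by
    have := hG.dist_triangle (u := r) (v := v) (w := u)
    rwa [dist_eq_one_iff_adj.2 hvu] at this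
  have hd2 : G.dist r v < G.dist r u := by
    by_contra hcon
    exact h.complete v u hv (not_lt.1 hcon) hu
  have hlt : ∀ x : Fin n, pos x < t := by
    intro x
    by_cases hx : pos x = 0
    · omega
    · exact (h.pos_spec x hx).1
  have hge : ∀ x : Fin n, pos x ≤ (Function.update pos u t : ℕ → ℕ) x := by
    intro x
    by_cases hx : x = u
    · subst hx; rw [hu]; exact Nat.zero_le _
    · rw [hne x hx]
  have hnz : ∀ x : Fin n, pos x ≠ 0 → (Function.update pos u t : ℕ → ℕ) x ≠ 0 :=
    fun x hx => by rw [hold x hx]; exact hx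
  have hback : ∀ x : Fin n, (Function.update pos u t : ℕ → ℕ) x ≠ 0 →
      (Function.update pos u t : ℕ → ℕ) x < i → pos x ≠ 0 ∧ pos x < i := by
    intro x hx hxi
    have hxu : x ≠ u := by rintro rfl; omega
    rw [hne x hxu] at hx hxi
    exact ⟨hx, hxi⟩
  constructor
  · exact hi
  · omega
  · rw [hold r (by rw [h.root]; omega), h.root]
  · intro k h1 h2
    by_cases hk : k = t
    · subst hk
      exact ⟨u, Function.update_self .., hself⟩
    · obtain ⟨x, hx, hxk⟩ := h.queue k h1 (by omega)
      exact ⟨x, by rw [hQ k (by omega), hx], by rw [hold x (by omega), hxk]⟩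
  · intro x hx
    by_cases hxu : x = u
    · subst hxu
      rw [hself]
      exact ⟨by omega, Function.update_self ..⟩
    · rw [hne x hxu] at hx ⊢
      have := h.pos_spec x hx
      exact ⟨by omega, by rw [hQ _ this.1, this.2]⟩
  · intro x y hx hxy
    by_cases hxu : x = u
    · subst hxu
      rw [hself] at hxy
      have hyx : y ≠ x := by rintro rfl; omega
      rw [hne y hyx] at hxy
      have := hlt y
      omega
    · rw [hne x hxu] at hx hxy
      by_cases hyu : y = u
      · subst hyu
        have := h.near v x hv.ge hx
        omega
      · rw [hne y hyu] at hxy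
        exact h.mono x y hx hxy
  · intro x y hx hy
    have hxv : G.dist r v ≤ G.dist r x := by
      by_cases hxu : x = u
      · subst hxu; omega
      · rw [hne x hxu] at hx
        rcases hx.lt_or_eq with h1 | h1
        · exact h.mono v x (by omega) (by omega)
        · rw [h.pos_injective (x := v) (y := x) (by omega) (by omega)]
    by_cases hyu : y = u
    · subst hyu; omega
    · rw [hne y hyu] at hy
      have := h.near v y hv.ge hy
      omega
  · intro x y hx hd
    have hxu : x ≠ u := by rintro rfl; omega
    rw [hne x hxu] at hx
    exact hnz y (h.complete x y hx hd)
  · intro x y hx hxi hxy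
    obtain ⟨h1, h2⟩ := hback x hx hxi
    exact hnz y (h.closed x y h1 h2 hxy)
  · exact h.root_label
  · intro x hx hxi
    obtain ⟨h1, h2⟩ := hback x hx hxi
    exact (h.label_le x h1 h2).trans (hge x)
  · intro x hxr hx hxi
    obtain ⟨h1, h2⟩ := hback x hx hxi
    refine (h.label x hxr h1 h2).congr (fun w => ?_) (hold x h1) fun _ _ => rfl
    unfold IsEarlier
    rw [hold x h1]
    by_cases hw : w = u
    · subst hw
      rw [hself, hu]
      constructor
      · rintro ⟨_, _, h3⟩; omega
      · rintro ⟨_, h3, _⟩; omega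
    · rw [hne w hw]

/-- The point is `complete` for the next head x, which may open a new layer. -/
theorem advance (h : G.SearchState r i t Q pos c p) (hG : G.Connected) {v : Fin n}
    (hv : pos v = i) (hclosed : ∀ u, G.Adj v u → pos u ≠ 0) {m a : ℕ} (hm : m ≤ i)
    (hroot : v = r → m = 0) (hlabel : v ≠ r → G.LabelSpec pos c v m a) :
    G.SearchState r (i + 1) t Q pos (Function.update c v m) (Function.update p v a) := by
  have hi := h.one_le
  have hit : i < t := hv ▸ (h.pos_spec v (by omega)).1
  have hne : ∀ (f : ℕ → ℕ) (b : ℕ) (x : Fin n), x ≠ v → Function.update f v b x = f x :=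
    fun f b x hx => Function.update_of_ne (fun hc => hx (Fin.ext hc)) ..
  have hsplit : ∀ x : Fin n, pos x < i + 1 → x = v ∨ x ≠ v ∧ pos x < i := by
    intro x hx
    by_cases hxv : x = v
    · exact .inl hxv
    · refine .inr ⟨hxv, ?_⟩
      rcases (Nat.lt_succ_iff.1 hx).lt_or_eq with h1 | h1
      · exact h1
      · exact absurd (h.pos_injective (x := x) (y := v) (by omega) (by omega)) hxv
  have hcl : ∀ x y : Fin n, pos x ≠ 0 → pos x < i + 1 → G.Adj x y → pos y ≠ 0 := by
    intro x y hx hxi hxy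
    rcases hsplit x hxi with rfl | ⟨_, h1⟩
    · exact hclosed y hxy
    · exact h.closed x y hx h1 hxy
  have hlab : ∀ x : Fin n, pos x < i + 1 → ∀ m' a', G.LabelSpec pos c x m' a' →
      G.LabelSpec pos (Function.update c v m) x m' a' := by
    intro x hx m' a' hs
    refine hs.congr (fun _ => Iff.rfl) rfl fun u hu => hne _ _ _ ?_
    rintro rfl
    have := hu.2.2
    omega
  constructor
  · omega
  · omega
  · exact h.root
  · exact h.queue
  · exact h.pos_spec
  · exact h.mono
  · intro x y hx hy
    exact h.near x y (by omega) hy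
  · intro x y hx hd
    have h1 := h.near v x hv.ge (by omega)
    by_cases h2 : G.dist r y ≤ G.dist r v
    · exact h.complete v y hv h2
    · obtain ⟨z, hyz, hz⟩ := hG.exists_adj_dist_eq (x := y) (u := r) (k := G.dist r v)
        (by rw [G.dist_comm (u := y)]; omega)
      rw [G.dist_comm] at hz
      have hz0 := h.complete v z hv (by omega)
      refine hcl z y hz0 ?_ hyz.symm
      by_contra h3
      rcases (not_lt.1 h3).lt_or_eq with h4 | h4
      · have := h.mono x z (by omega) (by omega)
        omega
      · rw [h.pos_injective (x := x) (y := z) (by omega) (by omega)] at h1 hd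
        omega
  · exact hcl
  · intro _
    by_cases hvr : v = r
    · subst hvr
      rw [Function.update_self, hroot rfl]
    · rw [hne _ _ _ (Ne.symm hvr)]
      refine h.root_label ?_
      by_contra hcon
      exact hvr (h.pos_injective (by omega) (by rw [h.root]; omega))
  · intro x hx hxi
    rcases hsplit x hxi with rfl | ⟨h1, h2⟩
    · rw [Function.update_self, hv]
      exact hm
    · rw [hne _ _ _ h1]
      exact h.label_le x hx h2
  · intro x hxr hx hxi
    rcases hsplit x hxi with rfl | ⟨h1, h2⟩
    · rw [Function.update_self, Function.update_self]
      exact hlab x hxi _ _ (hlabel hxr)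
    · rw [hne _ _ _ h1, hne _ _ _ h1]
      exact hlab x hxi _ _ (h.label x hxr hx h2)

theorem pos_ne_zero_of_finished (h : G.SearchState r t t Q pos c p) (hG : G.Connected)
    (x : Fin n) : pos x ≠ 0 := by
  obtain ⟨q⟩ := hG.preconnected x r
  induction q with
  | nil => rw [h.root]; omega
  | cons hadj _ ih =>
    have h1 := ih h
    exact h.closed _ _ h1 (h.pos_spec _ h1).1 hadj.symm

theorem isDistanceNumbering (h : G.SearchState r t t Q pos c p) (hG : G.Connected) :
    G.IsDistanceNumbering r fun x : Fin n => pos x :=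
  ⟨fun x _ hxy => h.pos_injective (h.pos_ne_zero_of_finished hG x) hxy,
    fun u v huv => h.mono u v (h.pos_ne_zero_of_finished hG u) huv⟩

theorem eq_succ_of_finished (h : G.SearchState r t t Q pos c p) (hG : G.Connected) :
    t = n + 1 := by
  refine le_antisymm h.le_succ ?_
  have : (Finset.univ : Finset (Fin n)).card ≤ (Finset.Ico 1 t).card := by
    refine Finset.card_le_card_of_injOn (fun x => pos x) (fun x _ => ?_) ?_
    · have h1 := h.pos_ne_zero_of_finished hG x
      have h2 := h.pos_spec x h1
      rw [Finset.coe_Ico]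
      exact Set.mem_Ico.2 ⟨Nat.pos_of_ne_zero h1, h2.1⟩
    · exact fun x _ y _ hxy => (h.isDistanceNumbering hG).injective hxy
  simp only [Nat.card_Ico, Finset.card_univ, Fintype.card_fin] at this
  have := h.one_le
  omega

theorem exists_isLabelling (h : G.SearchState r t t Q pos c p) (hG : G.Connected) :
    ∃ par : Fin n → Fin n, (∀ v, v ≠ r → p v = par v) ∧
      G.IsLabelling r (fun x : Fin n => pos x) (fun x : Fin n => c x) par := by
  have hnz := h.pos_ne_zero_of_finished hG
  have hlab : ∀ v : Fin n, ∃ x : Fin n, v ≠ r → p v = x ∧ G.IsEarlier pos v x ∧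
      ∃ y : Fin n, G.IsEarlier pos v y ∧
        (∀ u, G.IsEarlier pos v u → c x ≤ c u ∧ c u ≤ c y) ∧
          c v = if c y = c x then pos v else c y := by
    intro v
    by_cases hv : v = r
    · exact ⟨r, fun hne => absurd hv hne⟩
    · obtain ⟨x, y, h1, h2, h3, h4, h5⟩ :=
        h.label v hv (hnz v) (h.pos_spec v (hnz v)).1
      exact ⟨x, fun _ => ⟨h1, h2, y, h3, h4, h5⟩⟩
  choose par hpar using hlab
  refine ⟨par, fun v hv => (hpar v hv).1, ?_⟩
  constructor
  · refine h.root_label ?_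
    rw [← h.root]
    exact (h.pos_spec r (hnz r)).1
  · exact fun v hv => (hpar v hv).2.1.1
  · exact fun v hv => (hpar v hv).2.1.2.2
  · intro v hv u hu hlt
    obtain ⟨_, _, _, _, hle, _⟩ := hpar v hv
    exact (hle u ⟨hu, hnz u, hlt⟩).1
  · intro v hv
    obtain ⟨_, _, y, hy, hle, hm⟩ := hpar v hv
    exact ⟨y, hy.1, hy.2.2, fun u hu hlt => (hle u ⟨hu, hnz u, hlt⟩).2, hm⟩

end SearchState

end SimpleGraph

/-! ### Collecting the weights of the halfspaces in reverse order. -/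

namespace SimpleGraph

/-- The state of the computation of the weights of the halfspaces, from which the weights of the
vertices with numbers greater than `i` have been moved to their parents. -/
structure SweepState {n : ℕ} (G : SimpleGraph (Fin n)) (w : Fin n → ℝ) (r : Fin n)
    (pos : Fin n → ℕ) (i : ℕ) (A R : ℕ → ℝ) (ans : ℝ) : Prop where
  weight : ∀ S ∈ G.halfspaces r, R (firstPos pos S) +
    ∑ x : Fin n, S.indicator (fun x => if pos x ≤ i then A x else 0) x = setWeight w S
  zero : ∀ l, (∀ S ∈ G.halfspaces r, firstPos pos S ≠ l) → R l = 0
  ans_eq : ans = ∑ l ∈ Finset.Ioc i n, R l * ((∑ x, w x) - R l)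

namespace SweepState

variable {n : ℕ} {G : SimpleGraph (Fin n)} {w : Fin n → ℝ} {r : Fin n} {pos : Fin n → ℕ} {i : ℕ}
  {A R : ℕ → ℝ} {ans : ℝ}

theorem init (hpos : ∀ x, pos x ≤ n) (hA : ∀ x : Fin n, A x = w x) :
    SweepState G w r pos n A 0 0 := by
  constructor
  · intro S _
    simp only [hpos, if_true, hA, Pi.zero_apply, zero_add]
    rfl
  · exact fun _ _ => rfl
  · simp

/-- Moving the weight of v to its parent changes the remaining weight of only one halfspace, the one
with label `c v`, and the booking at this label compensates for it. -/
theorem step (h : SweepState G w r pos i A R ans) (hG : G.IsMedianGraph)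
    (hp : G.IsDistanceNumbering r pos) {c : Fin n → ℕ} {p : Fin n → Fin n}
    (hc : G.IsLabelling r pos c p) {v : Fin n} (hv : pos v = i) (hvr : v ≠ r) (hi : i ≤ n) :
    SweepState G w r pos (i - 1) (Function.update A (p v) (A (p v) + A v))
      (Function.update R (c v) (R (c v) + A v))
      (ans + Function.update R (c v) (R (c v) + A v) i *
        ((∑ x, w x) - Function.update R (c v) (R (c v) + A v) i)) := by
  have hadj := hc.adj v hvr
  have hlt := hc.pos_lt v hvr
  have hmem := hG.halfspace_mem_of_pos_lt hp hadj hlt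
  have hfirst := hG.firstPos_parent hp hc hvr
  have hcle := hG.label_le hp hc hvr
  constructor
  · intro S hS
    rw [← h.weight S hS]
    have hsum : ∑ x : Fin n, S.indicator
          (fun x => if pos x ≤ i - 1 then Function.update A (p v) (A (p v) + A v) x else 0) x =
        ∑ x : Fin n, (S.indicator (fun x => if pos x ≤ i then A x else 0) x -
          (if x = v then S.indicator (fun _ => A v) v else 0) +
          if x = p v then S.indicator (fun _ => A v) (p v) else 0) := by
      refine Finset.sum_congr rfl fun x _ => ?_
      by_cases hxv : x = v
      · subst hxv
        have h1 : x ≠ p x := hadj.ne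
        have h2 : ¬ i ≤ i - 1 := by omega
        by_cases hxS : x ∈ S <;> simp [hxS, h1, hv, h2]
      · have hle : pos x ≤ i - 1 ↔ pos x ≤ i := by
          have : pos x ≠ i := fun hc => hxv (hp.injective (hc.trans hv.symm))
          omega
        by_cases hxp : x = p v
        · subst hxp
          have h3 : pos (p v) ≤ i := by omega
          by_cases hxS : p v ∈ S <;> simp [hxS, hxv, hle, h3]
        · have h4 : (x : ℕ) ≠ p v := fun hc => hxp (Fin.ext hc)
          by_cases hxS : x ∈ S <;> simp [hxS, hxv, hxp, hle, Function.update_of_ne h4]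
    rw [hsum, Finset.sum_add_distrib, Finset.sum_sub_distrib, Finset.sum_ite_eq' , Finset.sum_ite_eq',
      if_pos (Finset.mem_univ _), if_pos (Finset.mem_univ _)]
    have hiff := hG.mem_iff_of_pos_lt hp hadj hlt hS
    by_cases hST : S = G.halfspace v (p v)
    · have h1 : v ∈ S := hiff.2 (.inr hST)
      have h2 : p v ∉ S := by rw [hST]; exact IsMedianGraph.right_notMem_halfspace
      rw [Set.indicator_of_mem h1, Set.indicator_of_notMem h2, hST, hfirst, Function.update_self]
      ring
    · have h1 : firstPos pos S ≠ c v := fun hc =>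
        hST (hG.injOn_firstPos hp hS hmem (hc.trans hfirst.symm))
      rw [Function.update_of_ne h1]
      have h2 : v ∈ S ↔ p v ∈ S := by tauto
      by_cases h3 : v ∈ S
      · rw [Set.indicator_of_mem h3, Set.indicator_of_mem (h2.1 h3)]
        ring
      · rw [Set.indicator_of_notMem h3, Set.indicator_of_notMem (fun hc => h3 (h2.2 hc))]
        ring
  · intro l hl
    rw [Function.update_of_ne, h.zero l hl]
    rintro rfl
    exact hl _ hmem hfirst
  · have hIoc : Finset.Ioc (i - 1) n = insert i (Finset.Ioc i n) := by
      ext l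
      simp only [Finset.mem_Ioc, Finset.mem_insert]
      omega
    rw [hIoc, Finset.sum_insert (by simp), add_comm ans, h.ans_eq]
    congr 1
    refine Finset.sum_congr rfl fun l hl => ?_
    rw [Finset.mem_Ioc] at hl
    -- `c v ≤ i < l`: entries of R above i are final, so they could be evaluated already.
    rw [Function.update_of_ne (by omega)]

/-- Only the root still holds weight, and no halfspace in question contains it, so R holds the full
weights w(S). Numbers that are not gates contribute 0 by `zero`. -/
theorem ans_eq_wienerIndex (h : SweepState G w r pos 1 A R ans) (hG : G.IsMedianGraph)
    (hp : G.IsDistanceNumbering r pos) (hr : pos r = 1) (hn : ∀ x, pos x ≤ n) :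
    ans = G.wienerIndex w := by
  classical
  have hR : ∀ S ∈ G.halfspaces r, R (firstPos pos S) = setWeight w S := by
    intro S hS
    rw [← h.weight S hS, Finset.sum_eq_zero, add_zero]
    intro x _
    by_cases hx : x ∈ S
    · have hxr : r ≠ x := by rintro rfl; exact hS.1 hx
      have : pos r < pos x := by
        apply IsMedianGraph.pos_lt_of_dist_lt hp
        rw [dist_self]
        exact hG.connected.pos_dist_of_ne hxr
      rw [Set.indicator_of_mem hx, if_neg (by omega)]
    · rw [Set.indicator_of_notMem hx]
  have hfin := Set.toFinite (G.halfspaces r)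
  rw [hG.wienerIndex_eq_sum w r, finsum_mem_eq_finite_toFinset_sum _ hfin, h.ans_eq]
  have hsub : hfin.toFinset.image (firstPos pos) ⊆ Finset.Ioc 1 n := by
    intro l hl
    obtain ⟨S, hS, rfl⟩ := Finset.mem_image.1 hl
    rw [Set.Finite.mem_toFinset] at hS
    obtain ⟨g, _, hgp⟩ := IsMedianGraph.exists_pos_eq_firstPos hS pos
    rw [Finset.mem_Ioc, ← hr]
    exact ⟨hG.firstPos_pos hp hS, hgp ▸ hn g⟩
  rw [← Finset.sum_subset hsub, Finset.sum_image]
  · refine Finset.sum_congr rfl fun S hS => ?_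
    rw [Set.Finite.mem_toFinset] at hS
    rw [hR S hS]
    congr 1
    rw [sub_eq_iff_eq_add]
    unfold setWeight
    rw [← Finset.sum_add_distrib]
    refine Finset.sum_congr rfl fun x _ => ?_
    by_cases hx : x ∈ S <;> simp [hx]
  · rw [Set.Finite.coe_toFinset]
    exact hG.injOn_firstPos hp
  · intro l _ hl
    rw [h.zero l, zero_mul]
    intro S hS hSl
    exact hl (Finset.mem_image.2 ⟨S, hfin.mem_toFinset.2 hS, hSl⟩)

end SweepState

end SimpleGraph

/-! ### Rules for proving correctness and time bounds of programs. -/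

namespace RealRAM

namespace State

/-- Write `v` into word variable `x`. -/
def putWord (s : State) (x v : ℕ) : State :=
  { s with word := Function.update s.word x v }

/-- Write `v` at position `i` of the word array `a`. -/
def putWordArr (s : State) (a i v : ℕ) : State :=
  { s with wordArr := Function.update s.wordArr a (Function.update (s.wordArr a) i v) }

variable (s : State) (x y a b i v : ℕ) (z : ℝ)

@[simp] theorem word_putWord : (s.putWord x v).word y = if y = x then v else s.word y :=
  Function.update_apply ..
@[simp] theorem real_putWord : (s.putWord x v).real = s.real := rfl
@[simp] theorem wordArr_putWord : (s.putWord x v).wordArr = s.wordArr := rfl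
@[simp] theorem realArr_putWord : (s.putWord x v).realArr = s.realArr := rfl

@[simp] theorem word_putWordArr : (s.putWordArr a i v).word = s.word := rfl
@[simp] theorem real_putWordArr : (s.putWordArr a i v).real = s.real := rfl
@[simp] theorem wordArr_putWordArr : (s.putWordArr a i v).wordArr b =
    if b = a then Function.update (s.wordArr a) i v else s.wordArr b :=
  Function.update_apply ..
@[simp] theorem realArr_putWordArr : (s.putWordArr a i v).realArr = s.realArr := rfl

@[simp] theorem word_setReal : (s.setReal x z).word = s.word := rfl
@[simp] theorem real_setReal : (s.setReal x z).real y = if y = x then z else s.real y :=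
  Function.update_apply ..
@[simp] theorem wordArr_setReal : (s.setReal x z).wordArr = s.wordArr := rfl
@[simp] theorem realArr_setReal : (s.setReal x z).realArr = s.realArr := rfl

@[simp] theorem word_setRealArr : (s.setRealArr a i z).word = s.word := rfl
@[simp] theorem real_setRealArr : (s.setRealArr a i z).real = s.real := rfl
@[simp] theorem wordArr_setRealArr : (s.setRealArr a i z).wordArr = s.wordArr := rfl
@[simp] theorem realArr_setRealArr : (s.setRealArr a i z).realArr b =
    if b = a then Function.update (s.realArr a) i z else s.realArr b :=
  Function.update_apply ..

end State

/-- Started in state `s`, the program `p` stops within `T` steps in a state that satisfies `Q`. -/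
def WP (B : ℕ) (p : Program) (s : State) (T : ℕ) (Q : State → Prop) : Prop :=
  ∃ t s', Exec B p s t s' ∧ t ≤ T ∧ Q s'

/-- A sequence of instructions. -/
def block : List Instr → Program
  | [] => .skip
  | i :: l => .seq (.instr i) (block l)

namespace WP

variable {B : ℕ} {p q : Program} {b : Test} {s s' : State} {T T₁ T₂ : ℕ} {Q Q' : State → Prop}
  {l : List Instr}

theorem mono (h : WP B p s T₁ Q) (hT : T₁ ≤ T) (hQ : ∀ s, Q s → Q' s) : WP B p s T Q' := by
  obtain ⟨t, s', he, ht, hq⟩ := h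
  exact ⟨t, s', he, ht.trans hT, hQ s' hq⟩

theorem skip (h : Q s) : WP B .skip s 1 Q := ⟨1, s, .skip s, le_rfl, h⟩

theorem seq (h : WP B p s T₁ fun s' => WP B q s' T₂ Q) : WP B (.seq p q) s (T₁ + T₂) Q := by
  obtain ⟨t, s', he, ht, t', s'', he', ht', hq⟩ := h
  exact ⟨t + t', s'', .seq he he', Nat.add_le_add ht ht', hq⟩

theorem ite_true (hb : b.Holds s) (h : WP B p s T Q) : WP B (.ite b p q) s (1 + T) Q := by
  obtain ⟨t, s', he, ht, hq⟩ := h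
  exact ⟨1 + t, s', .ite_true hb he, Nat.add_le_add_left ht 1, hq⟩

theorem ite_false (hb : ¬ b.Holds s) (h : WP B q s T Q) : WP B (.ite b p q) s (1 + T) Q := by
  obtain ⟨t, s', he, ht, hq⟩ := h
  exact ⟨1 + t, s', .ite_false hb he, Nat.add_le_add_left ht 1, hq⟩

/-- The invariant of a loop contains a bound on the number of the remaining steps. -/
theorem loop {I : ℕ → State → Prop}
    (h : ∀ T s, I T s → (¬ b.Holds s ∧ 1 ≤ T ∧ Q s) ∨
      (b.Holds s ∧ ∃ T₁ T₂, 1 + T₁ + T₂ ≤ T ∧ WP B p s T₁ (I T₂))) :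
    ∀ T s, I T s → WP B (.loop b p) s T Q := by
  intro T
  induction T using Nat.strong_induction_on with
  | _ T ih =>
    intro s hI
    rcases h T s hI with ⟨hb, hT, hq⟩ | ⟨hb, T₁, T₂, hT, t, s', he, ht, hI'⟩
    · exact ⟨1, s, .loop_false hb, hT, hq⟩
    · obtain ⟨t', s'', he', ht', hq⟩ := ih T₂ (by omega) s' hI'
      exact ⟨1 + t + t', s'', .loop_true hb he he', by omega, hq⟩

/-- Each block ends with `skip`, so k instructions cost k + 1 steps; this is the innermost 1 of the
bounds below. -/
theorem nil (h : Q s) : WP B (block []) s 1 Q := skip h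

theorem cons {i : Instr} (hi : i.exec B s = some s') (h : WP B (block l) s' T Q) :
    WP B (block (i :: l)) s (1 + T) Q :=
  seq ⟨1, s', .instr hi, le_rfl, h⟩

theorem _root_.RealRAM.State.setWord_eq {x v : ℕ} (hv : v ≤ B) :
    s.setWord B x v = some (s.putWord x v) := if_pos hv

theorem _root_.RealRAM.State.setWordArr_eq {a i v : ℕ} (hv : v ≤ B) :
    s.setWordArr B a i v = some (s.putWordArr a i v) := if_pos hv

theorem wconst {x : ℕ} (c : ℕ) (hB : c ≤ B) (h : WP B (block l) (s.putWord x c) T Q) :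
    WP B (block (.wconst x c :: l)) s (1 + T) Q := cons (State.setWord_eq hB) h

theorem wmove {x y : ℕ} (v : ℕ) (hv : s.word y = v) (hB : v ≤ B)
    (h : WP B (block l) (s.putWord x v) T Q) : WP B (block (.wmove x y :: l)) s (1 + T) Q := by
  subst hv; exact cons (State.setWord_eq hB) h

theorem wop {o : Op} {x y z : ℕ} (v : ℕ) (hv : o.onWords (s.word y) (s.word z) = v) (hB : v ≤ B)
    (h : WP B (block l) (s.putWord x v) T Q) : WP B (block (.wop o x y z :: l)) s (1 + T) Q := by
  subst hv; exact cons (State.setWord_eq hB) h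

theorem wload {x a i : ℕ} (v : ℕ) (hv : s.wordArr a (s.word i) = v) (hB : v ≤ B)
    (h : WP B (block l) (s.putWord x v) T Q) : WP B (block (.wload x a i :: l)) s (1 + T) Q := by
  subst hv; exact cons (State.setWord_eq hB) h

theorem wstore {a i y : ℕ} (j v : ℕ) (hj : s.word i = j) (hv : s.word y = v) (hB : v ≤ B)
    (h : WP B (block l) (s.putWordArr a j v) T Q) :
    WP B (block (.wstore a i y :: l)) s (1 + T) Q := by
  subst hj hv; exact cons (State.setWordArr_eq hB) h

theorem rop {o : Op} {x y z : ℕ} (v : ℝ) (hv : o.onReals (s.real y) (s.real z) = v)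
    (h : WP B (block l) (s.setReal x v) T Q) : WP B (block (.rop o x y z :: l)) s (1 + T) Q := by
  subst hv; exact cons rfl h

theorem rload {x a i : ℕ} (v : ℝ) (hv : s.realArr a (s.word i) = v)
    (h : WP B (block l) (s.setReal x v) T Q) : WP B (block (.rload x a i :: l)) s (1 + T) Q := by
  subst hv; exact cons rfl h

theorem rstore {a i y : ℕ} (j : ℕ) (v : ℝ) (hj : s.word i = j) (hv : s.real y = v)
    (h : WP B (block l) (s.setRealArr a j v) T Q) :
    WP B (block (.rstore a i y :: l)) s (1 + T) Q := by
  subst hj hv; exact cons rfl h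

end WP

end RealRAM

/-! ### Adjacency lists and the scan of one list. -/

namespace RealRAM

variable {n : ℕ} {G : SimpleGraph (Fin n)} {off tgt : ℕ → ℕ}

namespace IsAdjacencyLists

theorem monotoneOn (h : IsAdjacencyLists G off tgt) {a b : ℕ} (hab : a ≤ b) (hb : b ≤ n) :
    off a ≤ off b := by
  induction b, hab using Nat.le_induction with
  | base => exact le_rfl
  | succ b _ ih => exact (ih (by omega)).trans (h.off_le b (by omega))

theorem sum_sub_eq (h : IsAdjacencyLists G off tgt) :
    ∑ v : Fin n, (off (v + 1) - off v) = off n := by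
  have key : ∀ k ≤ n, ∑ v ∈ Finset.range k, (off (v + 1) - off v) = off k := by
    intro k hk
    induction k with
    | zero => simp [h.off_zero]
    | succ k ih =>
      rw [Finset.sum_range_succ, ih (by omega)]
      have := h.off_le k (by omega)
      omega
  rw [Fin.sum_univ_eq_sum_range (fun v => off (v + 1) - off v), key n le_rfl]

theorem sub_eq_degree (h : IsAdjacencyLists G off tgt) [DecidableRel G.Adj] (v : Fin n) :
    off (v + 1) - off v = G.degree v := by
  have h1 := (h.lists v).image_eq
  have h2 := (h.lists v).injOn.ncard_image
  have h3 : {u : ℕ | ∃ x : Fin n, G.Adj v x ∧ u = x} =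
      (fun x : Fin n => (x : ℕ)) '' (G.neighborFinset v : Set (Fin n)) := by
    ext u
    simp [eq_comm]
  rw [h1, h3, Set.ncard_image_of_injective _ Fin.val_injective, Set.ncard_coe_finset,
    SimpleGraph.card_neighborFinset_eq_degree, ← Finset.coe_Ico, Set.ncard_coe_finset,
    Nat.card_Ico] at h2
  exact h2.symm

theorem off_eq (h : IsAdjacencyLists G off tgt) : off n = 2 * G.edgeSet.ncard := by
  classical
  rw [← h.sum_sub_eq, Finset.sum_congr rfl fun v _ => h.sub_eq_degree v,
    G.sum_degrees_eq_twice_card_edges, ← SimpleGraph.coe_edgeFinset, Set.ncard_coe_finset]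

theorem exists_adj (h : IsAdjacencyLists G off tgt) {v : Fin n} {j : ℕ} (h1 : off v ≤ j)
    (h2 : j < off (v + 1)) : ∃ u : Fin n, G.Adj v u ∧ tgt j = u :=
  (h.lists v).mapsTo ⟨h1, h2⟩

theorem exists_index (h : IsAdjacencyLists G off tgt) {v u : Fin n} (hvu : G.Adj v u) :
    ∃ j, off v ≤ j ∧ j < off (v + 1) ∧ tgt j = u := by
  obtain ⟨j, hj, hju⟩ := (h.lists v).surjOn ⟨u, hvu, rfl⟩
  exact ⟨j, hj.1, hj.2, hju⟩

end IsAdjacencyLists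

/-- The entries of `tgt` from position `lo` to position `j` have been scanned: they are all numbered,
and `mx` and `mn` are the extreme labels of those with numbers below `i`. -/
structure ScanState (tgt pos c : ℕ → ℕ) (i lo j mx mn arg : ℕ) : Prop where
  numbered : ∀ l, lo ≤ l → l < j → pos (tgt l) ≠ 0
  bounds : ∀ l, lo ≤ l → l < j → pos (tgt l) < i → mn ≤ c (tgt l) ∧ c (tgt l) ≤ mx
  mx_eq : mx = 0 ∨ ∃ l, lo ≤ l ∧ l < j ∧ pos (tgt l) < i ∧ c (tgt l) = mx
  mn_eq : (mn = i ∧ arg = 0 ∧ ∀ l, lo ≤ l → l < j → ¬ pos (tgt l) < i) ∨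
    ∃ l, lo ≤ l ∧ l < j ∧ pos (tgt l) < i ∧ c (tgt l) = mn ∧ arg = tgt l

namespace ScanState

variable {pos c : ℕ → ℕ} {i lo j mx mn arg : ℕ}

/-- The start value i of the minimum exceeds all labels of earlier neighbours, so the first of these
replaces it. -/
theorem init (tgt pos c : ℕ → ℕ) (i lo : ℕ) : ScanState tgt pos c i lo lo 0 i 0 :=
  ⟨fun _ _ _ => by omega, fun _ _ _ => by omega, .inl rfl, .inl ⟨rfl, rfl, fun _ _ _ => by omega⟩⟩

theorem later (h : ScanState tgt pos c i lo j mx mn arg) (hj : i ≤ pos (tgt j))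
    (hi : 1 ≤ i) : ScanState tgt pos c i lo (j + 1) mx mn arg := by
  have key : ∀ l, l < j + 1 → l < j ∨ l = j := fun l hl => by omega
  constructor
  · intro l h1 h2
    rcases key l h2 with h3 | rfl
    · exact h.numbered l h1 h3
    · omega
  · intro l h1 h2 h4
    rcases key l h2 with h3 | rfl
    · exact h.bounds l h1 h3 h4
    · omega
  · rcases h.mx_eq with h1 | ⟨l, h1, h2, h3⟩
    · exact .inl h1
    · exact .inr ⟨l, h1, by omega, h3⟩
  · rcases h.mn_eq with ⟨h1, ha, h2⟩ | ⟨l, h1, h2, h3⟩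
    · refine .inl ⟨h1, ha, fun l h3 h4 => ?_⟩
      rcases key l h4 with h5 | rfl
      · exact h2 l h3 h5
      · omega
    · exact .inr ⟨l, h1, by omega, h3⟩

/-- The entries scanned so far are numbered, so none of them is the vertex receiving a number now;
its number t ≥ i also keeps it out of the extremes. -/
theorem push (h : ScanState tgt pos c i lo j mx mn arg) (hj : pos (tgt j) = 0) {t : ℕ}
    (hi : 1 ≤ i) (hit : i ≤ t) :
    ScanState tgt (Function.update pos (tgt j) t) c i lo (j + 1) mx mn arg := by
  have hne : ∀ l, lo ≤ l → l < j → Function.update pos (tgt j) t (tgt l) = pos (tgt l) := by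
    intro l h1 h2
    apply Function.update_of_ne
    intro hc
    exact h.numbered l h1 h2 (hc ▸ hj)
  refine later ?_ (by rw [Function.update_self]; exact hit) hi
  constructor
  · intro l h1 h2
    rw [hne l h1 h2]
    exact h.numbered l h1 h2
  · intro l h1 h2
    rw [hne l h1 h2]
    exact h.bounds l h1 h2
  · rcases h.mx_eq with h1 | ⟨l, h1, h2, h3⟩
    · exact .inl h1
    · exact .inr ⟨l, h1, h2, by rwa [hne l h1 h2]⟩
  · rcases h.mn_eq with ⟨h1, ha, h2⟩ | ⟨l, h1, h2, h3⟩
    · refine .inl ⟨h1, ha, fun l h3 h4 => ?_⟩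
      rw [hne l h3 h4]
      exact h2 l h3 h4
    · exact .inr ⟨l, h1, h2, by rwa [hne l h1 h2]⟩

theorem earlier (h : ScanState tgt pos c i lo j mx mn arg) (h0 : pos (tgt j) ≠ 0)
    (hj : pos (tgt j) < i) (hc : c (tgt j) < i) (hlo : lo ≤ j) :
    ScanState tgt pos c i lo (j + 1) (if mx < c (tgt j) then c (tgt j) else mx)
      (if c (tgt j) < mn then c (tgt j) else mn) (if c (tgt j) < mn then tgt j else arg) := by
  have key : ∀ l, l < j + 1 → l < j ∨ l = j := fun l hl => by omega
  constructor
  · intro l h1 h2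
    rcases key l h2 with h3 | rfl
    · exact h.numbered l h1 h3
    · exact h0
  · intro l h1 h2 h4
    rcases key l h2 with h3 | rfl
    · have := h.bounds l h1 h3 h4
      constructor <;> split_ifs <;> omega
    · constructor <;> split_ifs <;> omega
  · split_ifs with hif
    · exact .inr ⟨j, hlo, by omega, hj, rfl⟩
    · rcases h.mx_eq with h1 | ⟨l, h1, h2, h3⟩
      · exact .inl h1
      · exact .inr ⟨l, h1, by omega, h3⟩
  · split_ifs with hif
    · exact .inr ⟨j, hlo, by omega, hj, rfl, rfl⟩
    · rcases h.mn_eq with ⟨h1, _, h2⟩ | ⟨l, h1, h2, h3⟩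
      · omega
      · exact .inr ⟨l, h1, by omega, h3⟩

variable {r v : Fin n} {t : ℕ} {Q p : ℕ → ℕ}

theorem isEarlier_iff (h : ScanState tgt pos c i (off v) (off (v + 1)) mx mn arg)
    (hadj : IsAdjacencyLists G off tgt) (hv : pos v = i) (u : Fin n) :
    G.IsEarlier pos v u ↔ ∃ l, off v ≤ l ∧ l < off (v + 1) ∧ tgt l = u ∧ pos (tgt l) < i := by
  constructor
  · rintro ⟨h1, _, h3⟩
    obtain ⟨l, hl, hl', hlu⟩ := hadj.exists_index h1
    exact ⟨l, hl, hl', hlu, by rw [hlu]; omega⟩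
  · rintro ⟨l, hl, hl', hlu, hlt⟩
    obtain ⟨x, hx, hlx⟩ := hadj.exists_adj hl hl'
    have : x = u := Fin.ext (hlx.symm.trans hlu)
    subst this
    have := h.numbered l hl hl'
    rw [hlu] at this hlt
    exact ⟨hx, this, by omega⟩

theorem advance (h : ScanState tgt pos c i (off v) (off (v + 1)) mx mn arg)
    (hs : G.SearchState r i t Q pos c p) (hG : G.Connected) (hadj : IsAdjacencyLists G off tgt)
    (hv : pos v = i) :
    G.SearchState r (i + 1) t Q pos (Function.update c v (if mx = mn then i else mx))
      (Function.update p v arg) := by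
  have hi := hs.one_le
  have hE := h.isEarlier_iff hadj hv
  have hlab : ∀ l, off v ≤ l → l < off (v + 1) → pos (tgt l) < i → c (tgt l) < i := by
    intro l h1 h2 h3
    obtain ⟨x, hx, hlx⟩ := hadj.exists_adj h1 h2
    have := h.numbered l h1 h2
    rw [hlx] at this h3 ⊢
    have := hs.label_le x this h3
    omega
  refine hs.advance hG hv ?_ ?_ ?_ ?_
  · intro u hu
    obtain ⟨l, hl, hl', hlu⟩ := hadj.exists_index hu
    rw [← hlu]
    exact h.numbered l hl hl'
  · split_ifs
    · exact le_rfl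
    · rcases h.mx_eq with h1 | ⟨l, h1, h2, h3, h4⟩
      · omega
      · have := hlab l h1 h2 h3
        omega
  -- The root has no earlier neighbour, so the start values 0 and i = 1 remain. They differ, hence
  -- the root gets the label 0 rather than its own number.
  · rintro rfl
    have hi1 : i = 1 := by rw [← hv, hs.root]
    have hno : ∀ l, off v ≤ l → l < off (v + 1) → ¬ pos (tgt l) < i := by
      intro l h1 h2 h3
      have := h.numbered l h1 h2
      omega
    have hmx : mx = 0 := by
      rcases h.mx_eq with h1 | ⟨l, h1, h2, h3, _⟩
      · exact h1
      · exact absurd h3 (hno l h1 h2)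
    have hmn : mn = i := by
      rcases h.mn_eq with h1 | ⟨l, h1, h2, h3, _⟩
      · exact h1.1
      · exact absurd h3 (hno l h1 h2)
    rw [if_neg (by omega), hmx]
  · intro hvr
    obtain ⟨u, hu⟩ : ∃ u, G.IsEarlier pos v u := by
      obtain ⟨k, hk⟩ := Nat.exists_eq_succ_of_ne_zero (hG.pos_dist_of_ne hvr).ne'
      obtain ⟨u, hvu, hd⟩ := hG.exists_adj_dist_eq hk
      rw [G.dist_comm] at hk hd
      have h0 := hs.complete v u hv (by omega)
      refine ⟨u, hvu, h0, ?_⟩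
      by_contra hcon
      rcases (not_lt.1 hcon).lt_or_eq with h1 | h1
      · have := hs.mono v u (by omega) h1
        omega
      · exact hvu.ne (hs.pos_injective (by omega) h1)
    obtain ⟨l, hl, hl', hlu, hlt⟩ := (hE u).1 hu
    have hmn : ∃ x : Fin n, G.IsEarlier pos v x ∧ c x = mn ∧ arg = x := by
      rcases h.mn_eq with ⟨_, _, h1⟩ | ⟨l', h1, h2, h3, h4, h5⟩
      · exact absurd hlt (h1 l hl hl')
      · obtain ⟨x, hx, hlx⟩ := hadj.exists_adj h1 h2
        exact ⟨x, (hE x).2 ⟨l', h1, h2, hlx, h3⟩, by rw [← hlx, h4], by rw [← hlx, h5]⟩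
    have hmx : ∃ y : Fin n, G.IsEarlier pos v y ∧ c y = mx := by
      rcases h.mx_eq with h1 | ⟨l', h1, h2, h3, h4⟩
      · refine ⟨u, hu, ?_⟩
        have := h.bounds l hl hl' hlt
        rw [hlu] at this
        omega
      · obtain ⟨y, hy, hly⟩ := hadj.exists_adj h1 h2
        exact ⟨y, (hE y).2 ⟨l', h1, h2, hly, h3⟩, by rw [← hly, h4]⟩
    obtain ⟨x, hx, hxc, hxa⟩ := hmn
    obtain ⟨y, hy, hyc⟩ := hmx
    refine ⟨x, y, hxa, hx, hy, fun z hz => ?_, by rw [hxc, hyc, hv]⟩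
    obtain ⟨l', h1, h2, h3, h4⟩ := (hE z).1 hz
    have := h.bounds l' h1 h2 h4
    rwa [h3, ← hxc, ← hyc] at this

end ScanState

end RealRAM

/-! ### The program and its search phase. -/

namespace RealRAM

/-- Look at one neighbour of the current vertex. -/
def scanBody : Program :=
  -- Word variables: 2 the constant 1, 3 head and 4 tail of the queue, 5 the current vertex, 6 and 7
  -- position in and end of its list, 8 a neighbour, 9 its number, 13 its label, 10 and 11 largest
  -- and least label so far, 12 the candidate parent. Word arrays 2, 3, 4, 5: queue, numbers,
  -- labels, parents.
  .seq (block [.wload 8 1 6, .wload 9 3 8]) <|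
  .seq (.ite (.wlt 9 2)
    (block [.wstore 3 8 4, .wstore 2 4 8, .wop .add 4 4 2])
    (.ite (.wlt 9 3)
      (.seq (block [.wload 13 4 8]) <|
        .seq (.ite (.wlt 10 13) (block [.wmove 10 13]) .skip)
          (.ite (.wlt 13 11) (block [.wmove 11 13, .wmove 12 8]) .skip))
      .skip)) <|
  block [.wop .add 6 6 2]

/-- Deal with one vertex of the queue. -/
def searchBody : Program :=
  .seq (block [.wload 5 2 3, .wload 6 0 5, .wop .add 7 5 2, .wload 7 0 7, .wconst 10 0, .wconst 12 0,
    .wmove 11 3, .rload 2 0 5, .rop .add 1 1 2]) <|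
  .seq (.loop (.wlt 6 7) scanBody) <|
  .seq (.ite (.weq 10 11) (block [.wmove 10 3]) .skip) <|
  block [.wstore 4 5 10, .wstore 5 5 12, .wop .add 3 3 2]

/-- Move the weight of the last remaining vertex of the queue to its parent. -/
def sweepBody : Program :=
  block [.wload 5 2 3, .wload 10 4 5, .wload 12 5 5, .rload 2 0 5, .rload 3 1 10, .rop .add 3 3 2,
    -- Real array 0 holds the weights still at the vertices, real array 1 the weights booked under
    -- the labels; real variables 0 and 1 are the result and the total weight.
    .rstore 1 10 3, .rload 3 0 12, .rop .add 3 3 2, .rstore 0 12 3, .rload 3 1 3,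
    .rop .sub 4 1 3, .rop .mul 3 3 4, .rop .add 0 0 3, .wop .sub 3 3 2]

/-- The computation of the weighted Wiener index of a median graph: a breadth-first search from
the vertex `0` which labels the vertices, and a sweep in the reverse order. -/
def wienerProgram : Program :=
  -- Word variable 14 is never written, so it holds 0, the root.
  .seq (block [.wconst 2 1, .wconst 3 1, .wconst 4 2, .wstore 3 14 2]) <|
  .seq (.loop (.wlt 3 4) searchBody) <|
  .seq (block [.wop .sub 3 3 2]) <|
  .loop (.wlt 2 3) sweepBody

variable {n B : ℕ} {G : SimpleGraph (Fin n)} {w : Fin n → ℝ} {off tgt : ℕ → ℕ} {r v : Fin n} {i : ℕ}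
  {D : Finset (Fin n)} {tot : ℝ} {s : State}

/-- The state of the machine in the search, when the vertices in `D` have been dealt with. -/
structure ForwardState (G : SimpleGraph (Fin n)) (w : Fin n → ℝ) (off tgt : ℕ → ℕ) (r : Fin n)
    (i : ℕ) (D : Finset (Fin n)) (tot : ℝ) (s : State) : Prop where
  one : s.word 2 = 1
  head : s.word 3 = i
  off_eq : s.wordArr 0 = off
  tgt_eq : s.wordArr 1 = tgt
  search : G.SearchState r i (s.word 4) (s.wordArr 2) (s.wordArr 3) (s.wordArr 4) (s.wordArr 5)
  mem_done : ∀ x : Fin n, x ∈ D ↔ s.wordArr 3 x ≠ 0 ∧ s.wordArr 3 x < i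
  weights : ∀ x : Fin n, s.realArr 0 x = w x
  sums : s.realArr 1 = 0
  ans : s.real 0 = 0
  total : s.real 1 = tot

theorem ForwardState.putWord (h : ForwardState G w off tgt r i D tot s) {x y : ℕ} (hx : 4 < x) :
    ForwardState G w off tgt r i D tot (s.putWord x y) := by
  have h2 : (2 : ℕ) ≠ x := by omega
  have h3 : (3 : ℕ) ≠ x := by omega
  have h4 : (4 : ℕ) ≠ x := by omega
  constructor
  · simp [h2, h.one]
  · simp [h3, h.head]
  · exact h.off_eq
  · exact h.tgt_eq
  · simpa [h4] using h.search
  · exact h.mem_done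
  · exact h.weights
  · exact h.sums
  · exact h.ans
  · exact h.total

theorem ForwardState.push (h : ForwardState G w off tgt r i D tot s) (hG : G.Connected)
    (hv : s.wordArr 3 v = i) {u : Fin n} (hvu : G.Adj v u) (hu : s.wordArr 3 u = 0) :
    ForwardState G w off tgt r i D tot
      (((s.putWordArr 3 u (s.word 4)).putWordArr 2 (s.word 4) u).putWord 4 (s.word 4 + 1)) := by
  constructor
  · simp [h.one]
  · simp [h.head]
  · simp [h.off_eq]
  · simp [h.tgt_eq]
  · simpa using h.search.push hG hv hvu hu
  · intro x
    have hle := h.search.le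
    rw [h.mem_done]
    simp only [State.wordArr_putWord, State.wordArr_putWordArr]
    norm_num
    by_cases hx : x = u
    · subst hx
      rw [Function.update_self, hu]
      omega
    · rw [Function.update_of_ne (fun hc => hx (Fin.ext hc))]
  · exact h.weights
  · exact h.sums
  · exact h.ans
  · exact h.total

/-- The state of the machine while it looks at the neighbours of `v`. -/
structure InnerState (G : SimpleGraph (Fin n)) (w : Fin n → ℝ) (off tgt : ℕ → ℕ) (r : Fin n)
    (i : ℕ) (D : Finset (Fin n)) (tot : ℝ) (v : Fin n) (s : State) : Prop where
  forward : ForwardState G w off tgt r i D tot s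
  pos_eq : s.wordArr 3 v = i
  vertex : s.word 5 = v
  bound : s.word 7 = off (v + 1)
  lo_le : off v ≤ s.word 6
  le_hi : s.word 6 ≤ off (v + 1)
  scan : ScanState tgt (s.wordArr 3) (s.wordArr 4) i (off v) (s.word 6) (s.word 10) (s.word 11)
    (s.word 12)

theorem wp_scanBody (hG : G.Connected) (hadj : IsAdjacencyLists G off tgt) (hB1 : n + 1 ≤ B)
    (hB2 : off n ≤ B) (h : InnerState G w off tgt r i D tot v s) (hj : s.word 6 < off (v + 1)) :
    WP B scanBody s 16 fun s' =>
      InnerState G w off tgt r i D tot v s' ∧ s'.word 6 = s.word 6 + 1 := by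
  obtain ⟨u, hvu, hu⟩ := hadj.exists_adj h.lo_le hj
  have hf := h.forward
  have hs := hf.search
  have hi := hs.one_le
  have hoff := hadj.monotoneOn (a := v + 1) (b := n) v.2 le_rfl
  have hit : i < s.word 4 := h.pos_eq ▸ (hs.pos_spec v (by rw [h.pos_eq]; omega)).1
  have hts := hs.le_succ
  have hpos : s.wordArr 3 u ≤ n := by
    by_cases h0 : s.wordArr 3 u = 0
    · omega
    · have := (hs.pos_spec u h0).1
      omega
  have hun := u.2
  -- The longest branch, for an earlier neighbour that changes both extremes, takes 11 steps.
  refine WP.mono (T₁ := (1 + (1 + 1)) + (11 + (1 + 1))) (Q := fun s' =>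
      InnerState G w off tgt r i D tot v s' ∧ s'.word 6 = s.word 6 + 1) ?_ (by omega)
    fun _ h => h
  refine WP.seq ?_
  refine WP.wload u (by rw [hf.tgt_eq, hu]) (by omega) ?_
  refine WP.wload (s.wordArr 3 u) (by simp) (by omega) (WP.nil ?_)
  refine WP.seq ?_
  by_cases h0 : s.wordArr 3 u = 0
  · refine WP.mono (WP.ite_true (T := 1 + (1 + (1 + 1))) ?_ ?_) (by omega) fun _ h => h
    · simp [Test.Holds, hf.one, h0]
    refine WP.wstore u (s.word 4) (by simp) (by simp) (by omega) ?_
    refine WP.wstore (s.word 4) u (by simp) (by simp) (by omega) ?_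
    refine WP.wop (s.word 4 + 1) (by simp [Op.onWords, hf.one]) ?_ (WP.nil ?_)
    · have := (hs.push hG h.pos_eq hvu h0).le_succ
      omega
    refine WP.wop (s.word 6 + 1) (by simp [Op.onWords, hf.one]) (by omega) (WP.nil ⟨?_, by simp⟩)
    have hvu' : (v : ℕ) ≠ u := fun hc => hvu.ne (Fin.ext hc)
    have hsc := h.scan.push (by rw [hu]; exact h0) hi hit.le
    rw [hu] at hsc
    have hf' := ((hf.putWord (x := 8) (y := u) (by omega)).putWord (x := 9)
      (y := s.wordArr 3 u) (by omega)).push hG h.pos_eq hvu h0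
    simp only [State.word_putWord] at hf'
    norm_num at hf'
    refine ⟨hf'.putWord (by omega), ?_, ?_, ?_, ?_, ?_, ?_⟩
    · simp [Function.update_of_ne hvu', h.pos_eq]
    · simp [h.vertex]
    · simp [h.bound]
    · simp only [State.word_putWord, if_true]
      have := h.lo_le
      omega
    · simp only [State.word_putWord, if_true]
      omega
    · simpa using hsc
  · have hge : 1 ≤ s.wordArr 3 u := Nat.pos_of_ne_zero h0
    by_cases hlt : s.wordArr 3 u < i
    · have hcu := hs.label_le u h0 hlt
      have hsc := h.scan.earlier (by rw [hu]; exact h0) (by rw [hu]; exact hlt)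
        (by rw [hu]; omega) h.lo_le
      rw [hu] at hsc
      refine WP.mono (WP.ite_false (T := 1 + ((1 + 1) + ((1 + (1 + 1)) + (1 + (1 + (1 + 1))))))
        ?_ ?_) (by omega) fun _ h => h
      · simp [Test.Holds, hf.one, h0]
      refine WP.ite_true ?_ ?_
      · simp [Test.Holds, hf.head, hlt]
      refine WP.seq ?_
      refine WP.wload (s.wordArr 4 u) (by simp) (by omega) (WP.nil ?_)
      refine WP.seq ?_
      by_cases h1 : s.word 10 < s.wordArr 4 u
      all_goals by_cases h2 : s.wordArr 4 u < s.word 11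
      all_goals first
        | refine WP.ite_true (by simpa [Test.Holds] using h1) ?_
          refine WP.wmove (s.wordArr 4 u) (by simp) (by omega) (WP.nil ?_)
        | refine WP.ite_false (by simpa [Test.Holds] using h1) ?_
          refine WP.mono (WP.skip ?_) (by omega) fun _ h => h
      all_goals first
        | refine WP.ite_true (by simpa [Test.Holds] using h2) ?_
          refine WP.wmove (s.wordArr 4 u) (by simp) (by omega) ?_
          refine WP.wmove u (by simp) (by omega) (WP.nil ?_)
        | refine WP.ite_false (by simpa [Test.Holds] using h2) ?_
          refine WP.mono (WP.skip ?_) (by omega) fun _ h => h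
      all_goals
        refine WP.wop (s.word 6 + 1) (by simp [Op.onWords, hf.one]) (by omega)
          (WP.nil ⟨⟨?_, ?_, ?_, ?_, ?_, ?_, ?_⟩, by simp⟩)
        · repeat apply ForwardState.putWord (hx := by omega)
          exact hf
        · exact h.pos_eq
        · simp [h.vertex]
        · simp [h.bound]
        · simp only [State.word_putWord, if_true]
          have := h.lo_le
          omega
        · simp only [State.word_putWord, if_true]
          omega
        · simpa [h1, h2] using hsc
    · have hsc := h.scan.later (by rw [hu]; omega) hi
      refine WP.mono (WP.ite_false (T := 1 + 1) ?_ ?_) (by omega) fun _ h => h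
      · simp [Test.Holds, hf.one, h0]
      refine WP.ite_false ?_ ?_
      · simp [Test.Holds, hf.head, not_lt.1 hlt]
      refine WP.skip ?_
      refine WP.wop (s.word 6 + 1) (by simp [Op.onWords, hf.one]) (by omega)
        (WP.nil ⟨⟨?_, ?_, ?_, ?_, ?_, ?_, ?_⟩, by simp⟩)
      · repeat apply ForwardState.putWord (hx := by omega)
        exact hf
      · exact h.pos_eq
      · simp [h.vertex]
      · simp [h.bound]
      · simp only [State.word_putWord, if_true]
        have := h.lo_le
        omega
      · simp only [State.word_putWord, if_true]
        omega
      · simpa using hsc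

theorem wp_scanLoop (hG : G.Connected) (hadj : IsAdjacencyLists G off tgt) (hB1 : n + 1 ≤ B)
    (hB2 : off n ≤ B) (h : InnerState G w off tgt r i D tot v s) :
    WP B (.loop (.wlt 6 7) scanBody) s (17 * (off (v + 1) - s.word 6) + 1) fun s' =>
      InnerState G w off tgt r i D tot v s' ∧ s'.word 6 = off (v + 1) := by
  refine WP.loop (I := fun T s => InnerState G w off tgt r i D tot v s ∧
    T = 17 * (off (v + 1) - s.word 6) + 1) ?_ _ s ⟨h, rfl⟩
  rintro T s ⟨h, rfl⟩
  have hle := h.le_hi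
  by_cases hj : s.word 6 < off (v + 1)
  · exact .inr ⟨by simpa [Test.Holds, h.bound] using hj, 16,
      17 * (off (v + 1) - (s.word 6 + 1)) + 1, by omega,
      (wp_scanBody hG hadj hB1 hB2 h hj).mono le_rfl fun s' hs' => ⟨hs'.1, by rw [hs'.2]⟩⟩
  · exact .inl ⟨by simpa [Test.Holds, h.bound] using hj, by omega, h, by omega⟩

end RealRAM

namespace RealRAM

variable {n B : ℕ} {G : SimpleGraph (Fin n)} {w : Fin n → ℝ} {off tgt : ℕ → ℕ} {r v : Fin n}
  {i : ℕ} {D : Finset (Fin n)} {tot : ℝ} {s : State}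

theorem wp_labelVertex (hG : G.Connected) (hadj : IsAdjacencyLists G off tgt) (hB1 : n + 1 ≤ B)
    (h : InnerState G w off tgt r i D tot v s) (h6 : s.word 6 = off (v + 1)) :
    WP B (.seq (.ite (.weq 10 11) (block [.wmove 10 3]) .skip)
        (block [.wstore 4 5 10, .wstore 5 5 12, .wop .add 3 3 2])) s 7
      (ForwardState G w off tgt r (i + 1) (insert v D) tot) := by
  have hf := h.forward
  have hi := hf.search.one_le
  have hsc := h.scan
  rw [h6] at hsc
  have hs := hsc.advance hf.search hG hadj h.pos_eq
  have hts := hs.le_succ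
  have hile := hs.le
  have hmB : (if s.word 10 = s.word 11 then i else s.word 10) ≤ B := by
    split_ifs
    · omega
    · rcases hsc.mx_eq with h1 | ⟨l, h1, h2, h3, h4⟩
      · omega
      · obtain ⟨x, _, hx⟩ := hadj.exists_adj h1 h2
        have h5 := hsc.numbered l h1 h2
        rw [hx] at h3 h4 h5
        have := hf.search.label_le x h5 h3
        omega
  have haB : s.word 12 ≤ B := by
    rcases hsc.mn_eq with ⟨_, h1, _⟩ | ⟨l, h1, h2, _, _, h3⟩
    · omega
    · obtain ⟨x, _, hx⟩ := hadj.exists_adj h1 h2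
      have := x.2
      omega
  -- Both branches of the test reach a state of this form; skipping amounts to rewriting the old
  -- value of variable 10.
  have hend : ∀ s' : State, (∃ m, s' = s.putWord 10 m ∧
      m = if s.word 10 = s.word 11 then i else s.word 10) →
      WP B (block [.wstore 4 5 10, .wstore 5 5 12, .wop .add 3 3 2]) s' (1 + (1 + (1 + 1)))
        (ForwardState G w off tgt r (i + 1) (insert v D) tot) := by
    rintro _ ⟨m, rfl, hm⟩
    rw [← hm] at hmB hs
    refine WP.wstore v m (by simp [h.vertex]) (by simp) hmB ?_
    refine WP.wstore v (s.word 12) (by simp [h.vertex]) (by simp) haB ?_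
    refine WP.wop (i + 1) (by simp [Op.onWords, hf.one, hf.head]) (by omega) (WP.nil ?_)
    constructor
    · simp [hf.one]
    · simp
    · simp [hf.off_eq]
    · simp [hf.tgt_eq]
    · simpa using hs
    · intro x
      simp only [State.wordArr_putWord, State.wordArr_putWordArr, Finset.mem_insert, hf.mem_done]
      norm_num
      by_cases hxv : x = v
      · subst hxv
        simp only [true_or, true_iff, h.pos_eq]
        omega
      · have : s.wordArr 3 x ≠ 0 → s.wordArr 3 x ≠ i := fun h0 hc =>
          hxv (hf.search.pos_injective h0 (hc.trans h.pos_eq.symm))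
        simp only [hxv, false_or]
        omega
    · exact hf.weights
    · exact hf.sums
    · exact hf.ans
    · exact hf.total
  refine WP.mono (T₁ := (1 + (1 + 1)) + (1 + (1 + (1 + 1)))) (WP.seq ?_) (by omega) fun _ h => h
  by_cases heq : s.word 10 = s.word 11
  · refine WP.ite_true (by simpa [Test.Holds] using heq) ?_
    exact WP.wmove i hf.head (by omega) (WP.nil (hend _ ⟨i, rfl, by rw [if_pos heq]⟩))
  · refine WP.ite_false (by simpa [Test.Holds] using heq) ?_
    refine WP.mono (WP.skip (hend _ ⟨s.word 10, ?_, by rw [if_neg heq]⟩)) (by omega) fun _ h => h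
    cases s
    simp [State.putWord]

/-- The vertex is chosen before the time bound because the bound depends on its degree; v ∉ D makes
each vertex pay only once. -/
theorem wp_searchBody (hG : G.Connected) (hadj : IsAdjacencyLists G off tgt) (hB1 : n + 1 ≤ B)
    (hB2 : off n ≤ B) (h : ForwardState G w off tgt r i D tot s) (hit : i < s.word 4) :
    ∃ v, v ∉ D ∧ WP B searchBody s (17 * (off (v + 1) - off v) + 18)
      (ForwardState G w off tgt r (i + 1) (insert v D) (tot + w v)) := by
  have hi := h.search.one_le
  obtain ⟨v, hQ, hv⟩ := h.search.queue i hi hit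
  have hvn := v.2
  have hoff := hadj.monotoneOn (a := v + 1) (b := n) v.2 le_rfl
  have hoff' := hadj.off_le v v.2
  have hts := h.search.le_succ
  refine ⟨v, by rw [h.mem_done]; omega, ?_⟩
  refine WP.mono (T₁ := (1 + (1 + (1 + (1 + (1 + (1 + (1 + (1 + (1 + 1))))))))) +
    ((17 * (off (v + 1) - off v) + 1) + 7)) ?_ (by omega) fun _ h => h
  refine WP.seq ?_
  refine WP.wload v (by rw [h.head, hQ]) (by omega) ?_
  refine WP.wload (off v) (by simp [h.off_eq]) (by omega) ?_
  refine WP.wop (v + 1) (by simp [Op.onWords, h.one]) (by omega) ?_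
  refine WP.wload (off (v + 1)) (by simp [h.off_eq]) (by omega) ?_
  refine WP.wconst 0 (by omega) ?_
  refine WP.wconst 0 (by omega) ?_
  refine WP.wmove i (by simp [h.head]) (by omega) ?_
  refine WP.rload (w v) (by simp [h.weights]) ?_
  refine WP.rop (tot + w v) (by simp [Op.onReals, h.total]) (WP.nil ?_)
  refine WP.mono (T₁ := (17 * (off (v + 1) - off v) + 1) + 7) (WP.seq ?_) (by omega) fun _ h => h
  refine WP.mono (wp_scanLoop (r := r) (i := i) (D := D) (tot := tot + w v) (v := v) (w := w)
    hG hadj hB1 hB2 ⟨⟨?_, ?_, ?_, ?_, ?_, ?_, ?_, ?_, ?_, ?_⟩, ?_, ?_, ?_, ?_, ?_, ?_⟩) ?_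
    fun s' hs' => wp_labelVertex hG hadj hB1 hs'.1 hs'.2
  · simp [h.one]
  · simp [h.head]
  · simp [h.off_eq]
  · simp [h.tgt_eq]
  · simpa using h.search
  · exact h.mem_done
  · exact h.weights
  · exact h.sums
  · simp [h.ans]
  · simp
  · exact hv
  · simp
  · simp
  · simp
  · simpa using hoff'
  · simpa using ScanState.init ..
  · simp

theorem wp_searchLoop (hG : G.Connected) (hadj : IsAdjacencyLists G off tgt) (hB1 : n + 1 ≤ B)
    (hB2 : off n ≤ B) (h : ForwardState G w off tgt r i ∅ 0 s) :
    WP B (.loop (.wlt 3 4) searchBody) s (17 * off n + 19 * n + 1) fun s' =>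
      ∃ D, ForwardState G w off tgt r (s'.word 4) D (∑ x ∈ D, w x) s' := by
  -- The cost charged to a vertex: 18 steps plus 17 per list entry for the body, and one for the
  -- loop test. The invariant keeps the remaining time plus the charges for D constant.
  set f : Fin n → ℕ := fun x => 17 * (off (x + 1) - off x) + 19 with hfdef
  have hf : ∑ x, f x = 17 * off n + 19 * n := by
    rw [hfdef, Finset.sum_add_distrib, ← Finset.mul_sum, hadj.sum_sub_eq]
    simp [mul_comm]
  refine WP.loop (I := fun T s => ∃ i D, ForwardState G w off tgt r i D (∑ x ∈ D, w x) s ∧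
    T + ∑ x ∈ D, f x = ∑ x, f x + 1) ?_ _ s ⟨i, ∅, by simpa using h, by simp [hf]⟩
  rintro T s ⟨i, D, h, hT⟩
  have hle : ∀ D : Finset (Fin n), ∑ x ∈ D, f x ≤ ∑ x, f x := fun D =>
    Finset.sum_le_sum_of_subset (Finset.subset_univ D)
  by_cases hit : i < s.word 4
  · obtain ⟨v, hvD, hwp⟩ := wp_searchBody hG hadj hB1 hB2 h hit
    have h1 := hle (insert v D)
    rw [Finset.sum_insert hvD] at h1
    have h2 : f v = 17 * (off (v + 1) - off v) + 19 := rfl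
    refine .inr ⟨by simpa [Test.Holds, h.head] using hit, _, T - f v, ?_,
      hwp.mono le_rfl fun s' hs' => ⟨i + 1, insert v D, ?_, ?_⟩⟩
    · omega
    · rwa [Finset.sum_insert hvD, add_comm (w v)]
    · rw [Finset.sum_insert hvD]
      omega
  · have : i = s.word 4 := le_antisymm h.search.le (not_lt.1 hit)
    refine .inl ⟨by simpa [Test.Holds, h.head] using not_lt.1 hit, ?_, D, this ▸ h⟩
    have := hle D
    omega

/-! ### The sweep phase and the whole program. -/

/-- The state of the machine in the sweep. -/
structure BackwardState (G : SimpleGraph (Fin n)) (w : Fin n → ℝ) (r : Fin n) (Q pos c p : ℕ → ℕ)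
    (s : State) : Prop where
  one : s.word 2 = 1
  one_le : 1 ≤ s.word 3
  le : s.word 3 ≤ n
  queue_eq : s.wordArr 2 = Q
  label_eq : s.wordArr 4 = c
  parent_eq : s.wordArr 5 = p
  total : s.real 1 = ∑ x, w x
  sweep : G.SweepState w r (fun x => pos x) (s.word 3) (s.realArr 0) (s.realArr 1) (s.real 0)

theorem wp_sweepBody {Q pos c p : ℕ → ℕ} {par : Fin n → Fin n} {t : ℕ} (hG : G.IsMedianGraph)
    (hs : G.SearchState r t t Q pos c p) (hpar : ∀ x, x ≠ r → p x = par x)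
    (hlab : G.IsLabelling r (fun x : Fin n => pos x) (fun x : Fin n => c x) par)
    (hB : n + 1 ≤ B) (h : BackwardState G w r Q pos c p s) (hi : 1 < s.word 3) :
    WP B sweepBody s 16 fun s' =>
      BackwardState G w r Q pos c p s' ∧ s'.word 3 = s.word 3 - 1 := by
  have ht := hs.eq_succ_of_finished hG.connected
  have hp := hs.isDistanceNumbering hG.connected
  have hle := h.le
  obtain ⟨v, hQ, hv⟩ := hs.queue (s.word 3) h.one_le (by omega)
  have hvr : v ≠ r := by
    rintro rfl
    rw [hs.root] at hv
    omega
  have hcv := hG.label_le hp hlab hvr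
  have hvn := v.2
  have hpn := (par v).2
  have hstep := h.sweep.step hG hp hlab (v := v) hv hvr h.le
  refine WP.mono (T₁ := 1 + (1 + (1 + (1 + (1 + (1 + (1 + (1 + (1 + (1 + (1 + (1 + (1 + (1 +
    (1 + 1))))))))))))))) ?_ (by omega) fun _ h => h
  refine WP.wload v (by rw [h.queue_eq, hQ]) (by omega) ?_
  refine WP.wload (c v) (by simp [h.label_eq]) (by omega) ?_
  refine WP.wload (par v) (by simp [h.parent_eq, hpar v hvr]) (by omega) ?_
  refine WP.rload (s.realArr 0 v) (by simp) ?_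
  refine WP.rload (s.realArr 1 (c v)) (by simp) ?_
  refine WP.rop (s.realArr 1 (c v) + s.realArr 0 v) (by simp [Op.onReals]) ?_
  refine WP.rstore (c v) (s.realArr 1 (c v) + s.realArr 0 v) (by simp) (by simp) ?_
  refine WP.rload (s.realArr 0 (par v)) (by simp) ?_
  refine WP.rop (s.realArr 0 (par v) + s.realArr 0 v) (by simp [Op.onReals]) ?_
  refine WP.rstore (par v) (s.realArr 0 (par v) + s.realArr 0 v) (by simp) (by simp) ?_
  -- The entry at the current number is read after this update, which changes that very entry when v
  -- is a gate.
  set R := Function.update (s.realArr 1) (c v) (s.realArr 1 (c v) + s.realArr 0 v) with hR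
  refine WP.rload (R (s.word 3)) (by simp [hR]) ?_
  refine WP.rop ((∑ x, w x) - R (s.word 3)) (by simp [Op.onReals, h.total]) ?_
  refine WP.rop (R (s.word 3) * ((∑ x, w x) - R (s.word 3))) (by simp [Op.onReals]) ?_
  refine WP.rop (s.real 0 + R (s.word 3) * ((∑ x, w x) - R (s.word 3))) (by simp [Op.onReals]) ?_
  refine WP.wop (s.word 3 - 1) (by simp [Op.onWords, h.one]) (by omega) (WP.nil ⟨?_, by simp⟩)
  constructor
  · simp [h.one]
  · simp only [State.word_putWord, if_true]
    omega
  · simp only [State.word_putWord, if_true]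
    omega
  · simp [h.queue_eq]
  · simp [h.label_eq]
  · simp [h.parent_eq]
  · simp [h.total]
  · simpa [← hR] using hstep

theorem wp_sweepLoop {Q pos c p : ℕ → ℕ} {par : Fin n → Fin n} {t : ℕ} (hG : G.IsMedianGraph)
    (hs : G.SearchState r t t Q pos c p) (hpar : ∀ x, x ≠ r → p x = par x)
    (hlab : G.IsLabelling r (fun x : Fin n => pos x) (fun x : Fin n => c x) par)
    (hB : n + 1 ≤ B) (h : BackwardState G w r Q pos c p s) :
    WP B (.loop (.wlt 2 3) sweepBody) s (17 * n + 1) fun s' => s'.real 0 = G.wienerIndex w := by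
  refine WP.loop (I := fun T s => BackwardState G w r Q pos c p s ∧ 17 * s.word 3 + 1 ≤ T) ?_ _ s
    ⟨h, by have := h.le; omega⟩
  rintro T s ⟨h, hT⟩
  by_cases hi : 1 < s.word 3
  · refine .inr ⟨by simpa [Test.Holds, h.one] using hi, 16, T - 17, by omega,
      (wp_sweepBody hG hs hpar hlab hB h hi).mono le_rfl fun s' hs' => ⟨hs'.1, ?_⟩⟩
    rw [hs'.2]
    omega
  · refine .inl ⟨by simpa [Test.Holds, h.one] using hi, by omega, ?_⟩
    have h1 : s.word 3 = 1 := le_antisymm (not_lt.1 hi) h.one_le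
    have hsw := h.sweep
    rw [h1] at hsw
    refine hsw.ans_eq_wienerIndex hG (hs.isDistanceNumbering hG.connected) hs.root fun x => ?_
    have h2 := (hs.pos_spec x (hs.pos_ne_zero_of_finished hG.connected x)).1
    rw [hs.eq_succ_of_finished hG.connected] at h2
    omega

theorem wp_wienerProgram (hG : G.IsMedianGraph) (hadj : IsAdjacencyLists G off tgt)
    (hB1 : n + 1 ≤ B) (hB2 : off n ≤ B) :
    WP B wienerProgram (inputState G w off tgt) (17 * off n + 36 * n + 9) fun s =>
      s.real 0 = G.wienerIndex w := by
  obtain ⟨r₀⟩ := hG.connected.nonempty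
  have hn : 0 < n := r₀.pos
  refine WP.mono (T₁ := (1 + (1 + (1 + (1 + 1)))) + ((17 * off n + 19 * n + 1) + ((1 + 1) +
    (17 * n + 1)))) ?_ (by omega) fun _ h => h
  refine WP.seq ?_
  refine WP.wconst 1 (by omega) ?_
  refine WP.wconst 1 (by omega) ?_
  refine WP.wconst 2 (by omega) ?_
  refine WP.wstore 0 1 (by simp [inputState]) (by simp) (by omega) (WP.nil ?_)
  refine WP.seq ?_
  refine WP.mono (wp_searchLoop (r := ⟨0, hn⟩) (i := 1) (w := w) hG.connected hadj hB1 hB2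
    ⟨?_, ?_, ?_, ?_, ?_, ?_, ?_, ?_, ?_, ?_⟩) le_rfl ?_
  · simp
  · simp
  · simp [inputState]
  · simp [inputState]
  · have := SimpleGraph.SearchState.init hG.connected (r := ⟨0, hn⟩) rfl
    simpa [inputState, Pi.zero_def] using this
  · intro x
    simp only [State.wordArr_putWord, State.wordArr_putWordArr, if_true, Finset.notMem_empty,
      false_iff]
    by_cases hx : (x : ℕ) = 0
    · simp [hx]
    · simp [Function.update_of_ne hx, inputState]
  · intro x
    simp [inputState]
  · funext j
    simp [inputState]
  · simp [inputState]
  · simp [inputState]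
  rintro s ⟨D, h⟩
  have hs := h.search
  have ht := hs.eq_succ_of_finished hG.connected
  obtain ⟨par, hpar, hlab⟩ := hs.exists_isLabelling hG.connected
  have hD : D = Finset.univ := by
    ext x
    rw [h.mem_done]
    have h1 := hs.pos_ne_zero_of_finished hG.connected x
    simp [h1, (hs.pos_spec x h1).1]
  refine WP.seq ?_
  refine WP.wop n (by simp [Op.onWords, h.one, h.head, ht]) (by omega) (WP.nil ?_)
  refine wp_sweepLoop hG hs hpar hlab hB1 ⟨?_, ?_, ?_, rfl, rfl, rfl, ?_, ?_⟩
  · simp [h.one]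
  · simp only [State.word_putWord, if_true]
    exact hn
  · simp
  · simp [h.total, hD]
  · have := SimpleGraph.SweepState.init (G := G) (w := w) (r := ⟨0, hn⟩) (A := s.realArr 0)
      (pos := fun x => s.wordArr 3 x) (fun x => by
        have := (hs.pos_spec x (hs.pos_ne_zero_of_finished hG.connected x)).1
        omega) h.weights
    simpa [h.sums, h.ans] using this

end RealRAM

theorem proposition5p5 :
    -- the index as a sum over the Θ-classes
    (∀ (V : Type*) [Fintype V] [DecidableEq V] (G : SimpleGraph V) (w : V → ℝ),
      G.IsMedianGraph → (∀ v, 0 ≤ w v) →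
      ∃ H' H'' : Set (Sym2 V) → Set V,
        (∀ E ∈ G.thetaClasses, G.AreTheTwoComponents E (H' E) (H'' E)) ∧
        G.wienerIndex w = ∑ᶠ E ∈ G.thetaClasses, setWeight w (H' E) * setWeight w (H'' E)) ∧
    -- its computation in `O(m)` steps with words of `O(log n)` bits
    (∃ (P : RealRAM.Program) (C k : ℕ),
      ∀ (n : ℕ) (G : SimpleGraph (Fin n)) (w : Fin n → ℝ) (off tgt : ℕ → ℕ),
        G.IsMedianGraph → (∀ v, 0 ≤ w v) → RealRAM.IsAdjacencyLists G off tgt →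
        ∃ (t : ℕ) (s : RealRAM.State),
          RealRAM.Exec ((n + G.edgeSet.ncard + 1) ^ k) P (RealRAM.inputState G w off tgt) t s ∧
          t ≤ C * (G.edgeSet.ncard + 1) ∧
          s.real 0 = G.wienerIndex w) := by
  -- With `off n = 2 * m` and n ≤ m + 1 the time is at most 34 m + 36 (m + 1) + 9 ≤ 79 (m + 1). The
  -- exponent 2 makes room for list positions up to 2m, which may exceed n + m + 1.
  refine ⟨fun V _ _ G w hG _ => hG.exists_components_wienerIndex_eq w,
    RealRAM.wienerProgram, 79, 2, fun n G w off tgt hG _ hadj => ?_⟩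
  have hoff := hadj.off_eq
  have hn := hG.connected.card_vert_le_card_edgeSet_add_one
  rw [Nat.card_eq_fintype_card, Fintype.card_fin, Nat.card_coe_set_eq] at hn
  obtain ⟨t, s, he, ht, hs⟩ := RealRAM.wp_wienerProgram (w := w)
    (B := (n + G.edgeSet.ncard + 1) ^ 2) hG hadj (by nlinarith) (by nlinarith)
  exact ⟨t, s, he, ht.trans (by omega), hs⟩
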